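/- Let $X_1,X_2,\dots$ be i.i.d. with distribution $P$, let $d\ge 1$, $\beta_0\in\mathbb R^d$, and let $\tilde\beta_n$ be an estimation method (for each $n$ a measurable function of a sample of size $n$, with values in $\mathbb R^d$) that is asymptotically linear: $\sqrt n(\tilde\beta_n-\beta_0)=n^{-1/2}\sum_{i=1}^n\phi(X_i)+o_p(1)$ as $n\to\infty$, where $\tilde\beta_n$ is computed from $X_1,\dots,X_n$ and the influence function $\phi$, with values in $\mathbb R^d$, satisfies $E[\phi(X_1)]=0$, $E\|\phi(X_1)\|^2<\infty$ and $E[\phi(X_1)\phi(X_1)^T]$ is nonsingular. Let $m>d$ be a fixed integer. For each $n\ge m$ let $k=k_{m,n}$ be the largest integer with $mk\le n$, and $N=mk$. Draw $N$ of the $n$ observations uniformly at random without replacement, independently of the data, to obtain $X_1^*,\dots,X_N^*$. For $j=1,\dots,m$ let $\tilde\beta^*_{n,j}$ be the estimate computed from $X_1^*,\dots,X_N^*$ after omitting $X_j^*,X_{m+j}^*,X_{2m+j}^*,\dots,X_{(k-1)m+j}^*$. Put $$\bar\beta_n^*=\frac1m\sum_{j=1}^m\tilde\beta^*_{n,j},\qquad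 S_n^*=(m-1)\,k\sum_{j=1}^m(\tilde\beta^*_{n,j}-\bar\beta^*_n)(\tilde\beta^*_{n,j}-\bar\beta^*_n)^T .$$ Then, as $n\to\infty$, $S_n^*$ is nonsingular with probability tending to one, and $$n(\tilde\beta_n-\beta_0)^T[S_n^*]^{-1}(\tilde\beta_n-\beta_0)$$ (with $[S_n^*]^{-1}:=0$ where $S_n^*$ is singular) converges weakly to $\dfrac{d(m-1)}{m-d}\,F_{d,m-d}$, where $F_{r,s}$ has the $F$ distribution with $r$ and $s$ degrees of freedom. -/

import Mathlib

open MeasureTheory ProbabilityTheory Filter Topology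
open scoped Matrix

namespace BlockJackknife

/-- The chi-squared distribution with `r` degrees of freedom: the law of the sum of the squares of
`r` independent standard normal variables. -/
noncomputable def chiSquared (r : ℕ) : Measure ℝ :=
  (Measure.pi fun _ : Fin r => gaussianReal 0 1).map fun z => ∑ i, z i ^ 2

instance (r : ℕ) : IsProbabilityMeasure (chiSquared r) :=
  Measure.isProbabilityMeasure_map
    (Measurable.aemeasurable (f := fun z : Fin r → ℝ => ∑ i, z i ^ 2) (by fun_prop))

/-- The `F` distribution with `r` and `s` degrees of freedom: the law of `(U / r) / (V / s)` for
independent `U` and `V`, chi-squared with `r` and `s` degrees of freedom. -/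
noncomputable def fDist (r s : ℕ) : Measure ℝ :=
  ((chiSquared r).prod (chiSquared s)).map fun p => (p.1 / r) / (p.2 / s)

instance (r s : ℕ) : IsProbabilityMeasure (fDist r s) :=
  Measure.isProbabilityMeasure_map (by fun_prop)

/-- The largest integer `k` with `m * k ≤ n` (for `m > 0`). -/
def blockCount (m n : ℕ) : ℕ := n / m

/-- The number `m * k` of observations that are used by the jackknife. -/
def usedCount (m n : ℕ) : ℕ := m * blockCount m n

/-- The estimate from the observations `x i`, `i ∈ s`, taken in increasing order of `i`. An
estimation method `t` gives for each sample size a function of the sample. -/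
noncomputable def estimateOn {𝓧 E : Type*} (t : (n : ℕ) → (Fin n → 𝓧) → E) {N : ℕ}
    (s : Finset (Fin N)) (x : Fin N → 𝓧) : E :=
  t s.card fun i => x (s.orderEmbOfFin rfl i)

/-- The positions that remain when `j, m + j, 2 * m + j, …` are omitted (positions and `j` count
from `0`). -/
def keptPositions (m N : ℕ) (j : Fin m) : Finset (Fin N) :=
  Finset.univ.filter fun i => (i : ℕ) % m ≠ j

section Statistic

variable {𝓧 : Type*} {d : ℕ} (t : (n : ℕ) → (Fin n → 𝓧) → EuclideanSpace ℝ (Fin d)) (m n : ℕ)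

/-- The `j`-th jackknife estimate from the resampled data `xs`. -/
noncomputable def jackEstimate (xs : Fin (usedCount m n) → 𝓧) (j : Fin m) :
    EuclideanSpace ℝ (Fin d) :=
  estimateOn t (keptPositions m (usedCount m n) j) xs

/-- The mean of the `m` jackknife estimates. -/
noncomputable def jackMean (xs : Fin (usedCount m n) → 𝓧) : EuclideanSpace ℝ (Fin d) :=
  (m : ℝ)⁻¹ • ∑ j, jackEstimate t m n xs j

/-- The block jackknife covariance estimate. -/
noncomputable def jackCov (xs : Fin (usedCount m n) → 𝓧) : Matrix (Fin d) (Fin d) ℝ :=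
  (((m : ℝ) - 1) * (blockCount m n : ℝ)) • ∑ j,
    Matrix.vecMulVec (jackEstimate t m n xs j - jackMean t m n xs).ofLp
      (jackEstimate t m n xs j - jackMean t m n xs).ofLp

/-- The statistic `n (b - β₀)ᵀ S⁻¹ (b - β₀)`, where `b` is the estimate from the full sample `x`
and `S` is the block jackknife covariance estimate from the resampled data `xs`. -/
noncomputable def jackStat (β₀ : EuclideanSpace ℝ (Fin d)) (x : Fin n → 𝓧)
    (xs : Fin (usedCount m n) → 𝓧) : ℝ :=
  (n : ℝ) * ((t n x - β₀).ofLp ⬝ᵥ ((jackCov t m n xs)⁻¹ *ᵥ (t n x - β₀).ofLp))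

end Statistic

/-- The data after sampling without replacement: `σ n` picks the indices of the sampled
observations, in the order in which they are drawn. -/
def resample {Ω 𝓧 : Type*} (X : ℕ → Ω → 𝓧) (m : ℕ)
    (σ : (n : ℕ) → Ω → Fin (usedCount m n) → Fin n) (n : ℕ) (ω : Ω) :
    Fin (usedCount m n) → 𝓧 :=
  fun i => X (σ n ω i) ω

/-- The matrix `E[φ φᵀ]`. -/
noncomputable def secondMoment {𝓧 : Type*} [MeasurableSpace 𝓧] {d : ℕ} (P : Measure 𝓧)
    (φ : 𝓧 → EuclideanSpace ℝ (Fin d)) : Matrix (Fin d) (Fin d) ℝ :=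
  Matrix.of fun a b => ∫ x, φ x a * φ x b ∂P

end BlockJackknife

/-! Let Z_l be the sum of `φ` over the l-th block of the subsample, divided by √k. Omitting block j
leaves (m - 1)k observations, so asymptotic linearity gives √k (m - 1)(β*_j - β₀) = ∑_{l ≠ j} Z_l +
o_p(1). Fewer than m observations stay outside the subsample, so also √n (β̃_n - β₀) = m^{-1/2} ∑
Z_l + o_p(1). The subsample is itself i.i.d., hence by the central limit theorem the Z_l converge to
m independent centred Gaussian vectors with covariance E[φ φᵀ], and all rescaled errors converge
jointly (`tendstoInDistribution_rescaledErrors`).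

The statistic is a function of these errors (`jackStat_eq_hotelling`) that is continuous where their
scatter matrix is invertible and unchanged when one invertible linear map acts on all of them, so
the covariance may be taken to be the identity. The limit is then Hotelling's T² of m standard
Gaussian vectors in ℝ^d. Let W be the d columns of the data matrix, which are standard Gaussian in
ℝ^m, u the unit vector with equal entries, G the Gram matrix of W and a_i = ⟪W_i, u⟫. The limit
equals (m - 1) aᵀ(G - a aᵀ)⁻¹ a = (m - 1) ‖Pu‖² / ‖u - Pu‖², where P projects onto the span of W
(`projRatio_eq`).

By rotation and scale invariance, u may be replaced by a Gaussian g independent of W. Given W, ‖Pg‖²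
and ‖g - Pg‖² are independent chi-squared with d and m - d degrees of freedom (`map_projRatio`). The
same replacement shows that the limiting scatter matrix is almost surely invertible. -/

namespace BlockJackknife

/-! ### Linear algebra of the projection ratio -/

section Deterministic

variable {H : Type*} [NormedAddCommGroup H] [InnerProductSpace ℝ H] {d : ℕ}

/-- The matrix `‖u‖² G - a aᵀ`, where `G` is the Gram matrix of `W` and `a i = ⟪W i, u⟫`. For a
unit vector `u` it is the Gram matrix of the components of the `W i` orthogonal to `u`. -/
noncomputable def residualGram (u : H) (W : Fin d → H) : Matrix (Fin d) (Fin d) ℝ :=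
  ‖u‖ ^ 2 • Matrix.gram ℝ W
    - Matrix.vecMulVec (fun i => inner ℝ (W i) u) (fun i => inner ℝ (W i) u)

/-- The quadratic form of the inverse of `residualGram u W` at the vector of the `⟪W i, u⟫`. -/
noncomputable def projRatio (u : H) (W : Fin d → H) : ℝ :=
  (fun i => inner ℝ (W i) u) ⬝ᵥ ((residualGram u W)⁻¹ *ᵥ fun i => inner ℝ (W i) u)

lemma residualGram_mulVec (u : H) (W : Fin d → H) (v : Fin d → ℝ) :
    residualGram u W *ᵥ v = ‖u‖ ^ 2 • (Matrix.gram ℝ W *ᵥ v)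
      - ((fun i => inner ℝ (W i) u) ⬝ᵥ v) • fun i => inner ℝ (W i) u := by
  rw [residualGram, Matrix.sub_mulVec, Matrix.smul_mulVec, Matrix.vecMulVec_mulVec]
  ext i; simp

lemma gram_mulVec (W : Fin d → H) (v : Fin d → ℝ) (i : Fin d) :
    (Matrix.gram ℝ W *ᵥ v) i = inner ℝ (W i) (∑ j, v j • W j) := by
  simp [Matrix.mulVec, dotProduct, inner_sum, real_inner_smul_right, mul_comm]

/-- The vector c holds the coefficients of the projection Pu in terms of W. Then G c = a and a · c =
‖Pu‖², and Pythagoras turns ‖u‖² - ‖Pu‖² into ‖u - Pu‖². -/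
lemma exists_mulVec_residualGram [FiniteDimensional ℝ H] (u : H) (W : Fin d → H) :
    ∃ c : Fin d → ℝ,
      (fun i => inner ℝ (W i) u) ⬝ᵥ c
        = ‖(Submodule.span ℝ (Set.range W)).starProjection u‖ ^ 2 ∧
      residualGram u W *ᵥ c
        = ‖u - (Submodule.span ℝ (Set.range W)).starProjection u‖ ^ 2 •
          fun i => inner ℝ (W i) u := by
  set V := Submodule.span ℝ (Set.range W)
  obtain ⟨c, hc⟩ := (Submodule.mem_span_range_iff_exists_fun ℝ).1
    (V.starProjection_apply_mem u)
  have horth : ∀ w ∈ V, inner ℝ w u = inner ℝ w (V.starProjection u) := by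
    intro w hw
    have := V.starProjection_inner_eq_zero u w hw
    rw [real_inner_comm, inner_sub_right, sub_eq_zero] at this
    exact this
  have hq : (fun i => inner ℝ (W i) u) ⬝ᵥ c = ‖V.starProjection u‖ ^ 2 := by
    rw [← real_inner_self_eq_norm_sq, ← horth _ (V.starProjection_apply_mem u), ← hc]
    simp [dotProduct, sum_inner, real_inner_smul_left, mul_comm]
  refine ⟨c, hq, ?_⟩
  have hpyth : ‖u‖ ^ 2 = ‖V.starProjection u‖ ^ 2 + ‖u - V.starProjection u‖ ^ 2 := by
    have h0 : inner ℝ (V.starProjection u) (u - V.starProjection u) = (0 : ℝ) := by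
      rw [inner_sub_right, ← horth _ (V.starProjection_apply_mem u), sub_self]
    have := norm_add_sq_real (V.starProjection u) (u - V.starProjection u)
    rw [h0, add_sub_cancel] at this
    linarith
  rw [residualGram_mulVec, hq]
  ext i
  have hi : (Matrix.gram ℝ W *ᵥ c) i = inner ℝ (W i) u := by
    rw [gram_mulVec, hc, ← horth _ (Submodule.subset_span ⟨i, rfl⟩)]
  simp only [Pi.sub_apply, Pi.smul_apply, smul_eq_mul, hi, hpyth]
  ring

lemma isUnit_residualGram [FiniteDimensional ℝ H] {u : H} {W : Fin d → H} (hW : LinearIndependent ℝ W)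
    (hu : u ∉ Submodule.span ℝ (Set.range W)) : IsUnit (residualGram u W) := by
  set V := Submodule.span ℝ (Set.range W) with hV
  obtain ⟨c, -, hRc⟩ := exists_mulVec_residualGram u W
  have hs : ‖u - V.starProjection u‖ ^ 2 ≠ 0 := by
    intro h
    rw [sq_eq_zero_iff, norm_eq_zero, sub_eq_zero] at h
    exact hu (h ▸ V.starProjection_apply_mem u)
  have hu0 : ‖u‖ ^ 2 ≠ 0 := by
    rw [pow_ne_zero_iff two_ne_zero, norm_ne_zero_iff]
    rintro rfl
    exact hu (Submodule.zero_mem _)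
  have hsymm : (residualGram u W)ᵀ = residualGram u W := by
    ext i j
    simp [residualGram, Matrix.vecMulVec_apply, real_inner_comm, mul_comm]
  rw [← Matrix.mulVec_injective_iff_isUnit, ← Matrix.coe_mulVecLin, ← LinearMap.ker_eq_bot,
    LinearMap.ker_eq_bot']
  intro v hv
  rw [Matrix.coe_mulVecLin] at hv
  have hav : (fun i => inner ℝ (W i) u) ⬝ᵥ v = 0 := by
    -- By symmetry, pairing the kernel vector v with c gives ‖u - Pu‖² (a · v) = 0. The rank-one
    -- part then drops out and the invertible Gram matrix decides.
    have h1 : c ⬝ᵥ (residualGram u W *ᵥ v) = 0 := by rw [hv, dotProduct_zero]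
    rw [Matrix.dotProduct_mulVec, ← Matrix.mulVec_transpose, hsymm, hRc, smul_dotProduct,
      smul_eq_mul] at h1
    exact (mul_eq_zero.1 h1).resolve_left hs
  rw [residualGram_mulVec, hav, zero_smul, sub_zero] at hv
  have hG : Matrix.gram ℝ W *ᵥ v = 0 := (smul_eq_zero.1 hv).resolve_left hu0
  have hdet : IsUnit (Matrix.gram ℝ W) := by
    rw [Matrix.isUnit_iff_isUnit_det]
    exact (Matrix.det_gram_ne_zero_iff_linearIndependent.2 hW).isUnit
  exact Matrix.mulVec_injective_iff_isUnit.2 hdet (by rw [hG, Matrix.mulVec_zero])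

lemma projRatio_eq [FiniteDimensional ℝ H] {u : H} {W : Fin d → H} (hW : LinearIndependent ℝ W)
    (hu : u ∉ Submodule.span ℝ (Set.range W)) :
    projRatio u W = ‖(Submodule.span ℝ (Set.range W)).starProjection u‖ ^ 2
      / ‖u - (Submodule.span ℝ (Set.range W)).starProjection u‖ ^ 2 := by
  have hR := isUnit_residualGram hW hu
  set V := Submodule.span ℝ (Set.range W) with hV
  obtain ⟨c, hq, hRc⟩ := exists_mulVec_residualGram u W
  have hs : ‖u - V.starProjection u‖ ^ 2 ≠ 0 := by
    intro h
    rw [sq_eq_zero_iff, norm_eq_zero, sub_eq_zero] at h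
    exact hu (h ▸ V.starProjection_apply_mem u)
  have ha : (fun i => inner ℝ (W i) u)
      = residualGram u W *ᵥ ((‖u - V.starProjection u‖ ^ 2)⁻¹ • c) := by
    rw [Matrix.mulVec_smul, hRc, smul_smul, inv_mul_cancel₀ hs, one_smul]
  rw [projRatio]
  nth_rewrite 2 [ha]
  rw [Matrix.mulVec_mulVec, Matrix.nonsing_inv_mul _ ((Matrix.isUnit_iff_isUnit_det _).1 hR),
    Matrix.one_mulVec, dotProduct_smul, hq, smul_eq_mul, div_eq_inv_mul]

lemma residualGram_map (f : H ≃ₗᵢ[ℝ] H) (u : H) (W : Fin d → H) :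
    residualGram (f u) (fun i => f (W i)) = residualGram u W := by
  ext i j
  simp [residualGram, Matrix.vecMulVec_apply]

lemma projRatio_map (f : H ≃ₗᵢ[ℝ] H) (u : H) (W : Fin d → H) :
    projRatio (f u) (fun i => f (W i)) = projRatio u W := by
  rw [projRatio, residualGram_map, projRatio]
  simp

lemma residualGram_smul (c : ℝ) (u : H) (W : Fin d → H) :
    residualGram (c • u) W = c ^ 2 • residualGram u W := by
  ext i j
  simp [residualGram, Matrix.vecMulVec_apply, real_inner_smul_right, norm_smul, mul_pow]
  ring

/-- No invertibility is needed: if c = 0 or A is singular, both sides are 0 by the convention for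
inverses. -/
lemma inv_smul_matrix (c : ℝ) (A : Matrix (Fin d) (Fin d) ℝ) : (c • A)⁻¹ = c⁻¹ • A⁻¹ := by
  rcases eq_or_ne c 0 with rfl | hc
  · simp
  by_cases hA : IsUnit A.det
  · exact Matrix.inv_smul' A (Units.mk0 c hc) hA
  · have hcA : ¬ IsUnit (c • A).det := by
      rw [Matrix.det_smul]
      intro h
      exact hA (isUnit_of_mul_isUnit_right h)
    rw [Matrix.nonsing_inv_apply_not_isUnit _ hA, Matrix.nonsing_inv_apply_not_isUnit _ hcA,
      smul_zero]

/-- The factor ‖u‖² in `residualGram` is there for this: the matrix becomes homogeneous of degree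
two in u, like the product of the two outer vectors. -/
lemma projRatio_smul {c : ℝ} (hc : c ≠ 0) (u : H) (W : Fin d → H) :
    projRatio (c • u) W = projRatio u W := by
  have h : (fun i => inner ℝ (W i) (c • u)) = c • fun i => inner ℝ (W i) u := by
    ext i; simp [real_inner_smul_right]
  rw [projRatio, residualGram_smul, inv_smul_matrix, h, Matrix.smul_mulVec, Matrix.mulVec_smul,
    dotProduct_smul, dotProduct_smul, smul_dotProduct, projRatio]
  simp only [smul_eq_mul]
  field_simp

/-- In this form the quadratic form is a polynomial in the entries divided by the determinant, so
measurability and continuity off the singular set are immediate. -/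
lemma dotProduct_inv_mulVec (A : Matrix (Fin d) (Fin d) ℝ) (v : Fin d → ℝ) :
    v ⬝ᵥ (A⁻¹ *ᵥ v) = A.det⁻¹ * (v ⬝ᵥ (A.adjugate *ᵥ v)) := by
  rw [Matrix.inv_def, Ring.inverse_eq_inv', Matrix.smul_mulVec, dotProduct_smul, smul_eq_mul]

lemma continuous_residualGram (d : ℕ) :
    Continuous fun p : H × (Fin d → H) => residualGram p.1 p.2 := by
  refine continuous_matrix fun i j => ?_
  simp only [residualGram, Matrix.sub_apply, Matrix.smul_apply, Matrix.gram_apply,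
    Matrix.vecMulVec_apply]
  fun_prop

end Deterministic

/-! ### Standard Gaussian vectors and the law of the projection ratio -/

section Gaussian

variable {H : Type*} [NormedAddCommGroup H] [InnerProductSpace ℝ H] [FiniteDimensional ℝ H]
  [MeasurableSpace H] [BorelSpace H]

lemma map_norm_sq_stdGaussian :
    (stdGaussian H).map (fun x => ‖x‖ ^ 2) = chiSquared (Module.finrank ℝ H) := by
  rw [stdGaussian, Measure.map_map (by fun_prop) (by fun_prop), chiSquared]
  congr 1
  ext x
  have h : ∑ i, x i • stdOrthonormalBasis ℝ H i
      = (stdOrthonormalBasis ℝ H).repr.symm (WithLp.toLp 2 x) := by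
    rw [← OrthonormalBasis.sum_repr_symm]
  rw [Function.comp_apply, h, LinearIsometryEquiv.norm_map, EuclideanSpace.real_norm_sq_eq]

/-- The subspace lies in the kernel of ⟪w, ·⟫ for some w ≠ 0 orthogonal to it, and this functional
is a nondegenerate real Gaussian, which has no atom at 0. -/
lemma stdGaussian_submodule_eq_zero {V : Submodule ℝ H} (hV : V ≠ ⊤) :
    stdGaussian H (V : Set H) = 0 := by
  obtain ⟨w, hw, hw0⟩ := Submodule.exists_mem_ne_zero_of_ne_bot
    (mt Submodule.orthogonal_eq_bot_iff.1 hV)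
  have hmap := IsGaussian.map_eq_gaussianReal (μ := stdGaussian H) (innerSL ℝ w)
  have hvar : (Var[innerSL ℝ w; stdGaussian H]).toNNReal ≠ 0 := by
    rw [variance_dual_stdGaussian, innerSL_apply_norm]
    simpa using hw0
  have : NullSingletonClass ((stdGaussian H).map (innerSL ℝ w)) := by
    rw [hmap]; exact nullSingletonClass_gaussianReal hvar
  refine measure_mono_null (t := innerSL ℝ w ⁻¹' {0}) ?_ ?_
  · intro x hx
    simpa using (Submodule.mem_orthogonal' V w).1 hw x hx
  · rw [← Measure.map_apply (by fun_prop) (measurableSet_singleton _)]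
    exact measure_singleton _

lemma stdGaussian_prod_eq {K L : Type*} [NormedAddCommGroup K] [InnerProductSpace ℝ K]
    [FiniteDimensional ℝ K] [MeasurableSpace K] [BorelSpace K]
    [NormedAddCommGroup L] [InnerProductSpace ℝ L]
    [FiniteDimensional ℝ L] [MeasurableSpace L] [BorelSpace L] :
    (stdGaussian (WithLp 2 (K × L))).map WithLp.ofLp = (stdGaussian K).prod (stdGaussian L) := by
  have h : ((stdGaussian K).prod (stdGaussian L)).map (WithLp.toLp 2)
      = stdGaussian (WithLp 2 (K × L)) := by
    refine Measure.ext_of_charFun (funext fun t => ?_)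
    rw [charFun_prod, charFun_stdGaussian, charFun_stdGaussian, charFun_stdGaussian,
      ← Complex.exp_add, ← Complex.ofReal_pow ‖t‖, WithLp.prod_norm_sq_eq_of_L2 t]
    push_cast
    congr 1
    simp only [WithLp.fst, WithLp.snd]
    ring
  rw [← h, Measure.map_map (by fun_prop) (by fun_prop)]
  exact Measure.map_id

/-- The squared lengths of the components of a standard Gaussian vector in a subspace and in its
orthogonal complement are independent chi-squared variables. -/
lemma map_norm_sq_starProjection (V : Submodule ℝ H) :
    (stdGaussian H).map (fun g => (‖V.starProjection g‖ ^ 2, ‖g - V.starProjection g‖ ^ 2))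
      = (chiSquared (Module.finrank ℝ V)).prod (chiSquared (Module.finrank ℝ Vᗮ)) := by
  have h : (fun g => (‖V.starProjection g‖ ^ 2, ‖g - V.starProjection g‖ ^ 2))
      = (Prod.map (fun x : V => ‖x‖ ^ 2) (fun x : Vᗮ => ‖x‖ ^ 2))
        ∘ WithLp.ofLp ∘ V.orthogonalDecomposition := by
    ext g
    · simp
    · simp
  rw [h, ← Measure.map_map (by fun_prop) (by fun_prop),
    ← Measure.map_map (by fun_prop) (by fun_prop), stdGaussian_map, stdGaussian_prod_eq,
    ← Measure.map_prod_map _ _ (by fun_prop) (by fun_prop), map_norm_sq_stdGaussian,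
    map_norm_sq_stdGaussian]

lemma ae_linearIndependent (d : ℕ) (hd : d ≤ Module.finrank ℝ H) :
    ∀ᵐ W ∂(Measure.pi fun _ : Fin d => stdGaussian H), LinearIndependent ℝ W := by
  induction d with
  | zero => exact ae_of_all _ fun W => linearIndependent_empty_type
  | succ d ih =>
    have hmeas : MeasurableSet {W : Fin (d + 1) → H | LinearIndependent ℝ W} := by
      simp_rw [← Matrix.det_gram_ne_zero_iff_linearIndependent]
      refine (isOpen_ne.preimage (f := fun W : Fin (d + 1) → H => (Matrix.gram ℝ W).det)
        ?_).measurableSet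
      refine Continuous.matrix_det (continuous_matrix fun i j => ?_)
      simp only [Matrix.gram_apply]
      fun_prop
    have hmp := (measurePreserving_piFinSuccAbove (fun _ : Fin (d + 1) => stdGaussian H) 0).symm
    rw [← hmp.map_eq, ae_map_iff hmp.measurable.aemeasurable hmeas]
    refine (Measure.ae_prod_iff_ae_ae (hmp.measurable hmeas)).2 ?_
    -- The order of integration is exchanged: for fixed independent W, the new vector almost surely
    -- avoids the proper subspace spanned by W.
    refine (Measure.ae_ae_comm (p := fun (x : H) (W : Fin d → H) =>
      (MeasurableEquiv.piFinSuccAbove (fun _ : Fin (d + 1) => H) 0).symm (x, W)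
        ∈ {W | LinearIndependent ℝ W}) (hmp.measurable hmeas)).2 ?_
    filter_upwards [ih (by omega)] with W hW
    have hspan : Submodule.span ℝ (Set.range W) ≠ ⊤ := by
      intro h
      have := finrank_range_le_card (R := ℝ) W
      rw [Set.finrank, h, finrank_top, Fintype.card_fin] at this
      omega
    filter_upwards [compl_mem_ae_iff.2 (stdGaussian_submodule_eq_zero hspan)] with x hx
    have : (MeasurableEquiv.piFinSuccAbove (fun _ : Fin (d + 1) => H) 0).symm (x, W)
        = (Fin.cons x W : Fin (d + 1) → H) := by
      simp [MeasurableEquiv.piFinSuccAbove]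
      rfl
    rw [this]
    exact linearIndependent_finCons.2 ⟨hW, hx⟩

lemma measurable_projRatio (d : ℕ) :
    Measurable fun p : H × (Fin d → H) => projRatio p.1 p.2 := by
  simp only [projRatio, dotProduct_inv_mulVec]
  have h := continuous_residualGram (H := H) d
  have ha : Continuous fun p : H × (Fin d → H) => fun i => inner ℝ (p.2 i) p.1 := by fun_prop
  exact h.matrix_det.measurable.inv.mul
    (ha.dotProduct (h.matrix_adjugate.matrix_mulVec ha)).measurable

/-- A function of a vector and `d` further vectors that is invariant under rotations and under
rescaling of the first vector has the same law at `d` independent standard Gaussian vectors,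
whatever the first vector. -/
lemma map_eq_of_invariant {d : ℕ} {α : Type*} [MeasurableSpace α] {f : H → (Fin d → H) → α}
    (hf : Measurable (Function.uncurry f))
    (hrot : ∀ (R : H ≃ₗᵢ[ℝ] H) u W, f (R u) (fun i => R (W i)) = f u W)
    (hsmul : ∀ c : ℝ, c ≠ 0 → ∀ u W, f (c • u) W = f u W) {u v : H} (hu : u ≠ 0) (hv : v ≠ 0) :
    (Measure.pi fun _ : Fin d => stdGaussian H).map (f u)
      = (Measure.pi fun _ : Fin d => stdGaussian H).map (f v) := by
  have hnorm : ‖v‖ = ‖(‖v‖ / ‖u‖) • u‖ := by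
    rw [norm_smul, norm_div, norm_norm, norm_norm, div_mul_cancel₀ _ (norm_ne_zero_iff.2 hu)]
  have hc : ‖v‖ / ‖u‖ ≠ 0 := div_ne_zero (norm_ne_zero_iff.2 hv) (norm_ne_zero_iff.2 hu)
  -- The two vectors have equal length, so reflection in the hyperplane orthogonal to their
  -- difference exchanges them.
  set R := (ℝ ∙ (v - (‖v‖ / ‖u‖) • u))ᗮ.reflection
  have hR : R v = (‖v‖ / ‖u‖) • u := Submodule.reflection_sub hnorm
  have hmp : MeasurePreserving (fun (W : Fin d → H) i => R (W i))
      (Measure.pi fun _ => stdGaussian H) (Measure.pi fun _ => stdGaussian H) :=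
    measurePreserving_pi _ _ fun _ => ⟨R.continuous.measurable, stdGaussian_map R⟩
  have hfu : Measurable (f u) := hf.of_uncurry_left
  have : f v = f u ∘ fun (W : Fin d → H) i => R (W i) := by
    ext W
    rw [Function.comp_apply, ← hsmul _ hc u, ← hR, hrot]
  rw [this, ← Measure.map_map hfu hmp.measurable, hmp.map_eq]

/-- This trades a fixed vector for a random one: by `map_eq_of_invariant` the law given g is the
same for every g ≠ 0, so integrating over g changes nothing. -/
lemma map_uncurry_eq_of_invariant [Nontrivial H] {d : ℕ} {α : Type*} [MeasurableSpace α]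
    {f : H → (Fin d → H) → α}
    (hf : Measurable (Function.uncurry f))
    (hrot : ∀ (R : H ≃ₗᵢ[ℝ] H) u W, f (R u) (fun i => R (W i)) = f u W)
    (hsmul : ∀ c : ℝ, c ≠ 0 → ∀ u W, f (c • u) W = f u W) {u : H} (hu : u ≠ 0) :
    ((stdGaussian H).prod (Measure.pi fun _ : Fin d => stdGaussian H)).map (Function.uncurry f)
      = (Measure.pi fun _ : Fin d => stdGaussian H).map (f u) := by
  ext s hs
  rw [Measure.map_apply hf hs, Measure.prod_apply (hf hs)]
  have h0 : ∀ᵐ g ∂stdGaussian H, g ≠ 0 := by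
    have := stdGaussian_submodule_eq_zero (H := H) (V := ⊥) bot_ne_top
    filter_upwards [compl_mem_ae_iff.2 this] with g hg
    simpa using hg
  have : ∀ᵐ g ∂stdGaussian H, (Measure.pi fun _ : Fin d => stdGaussian H)
      (Prod.mk g ⁻¹' (Function.uncurry f ⁻¹' s))
        = (Measure.pi fun _ : Fin d => stdGaussian H).map (f u) s := by
    filter_upwards [h0] with g hg
    rw [map_eq_of_invariant hf hrot hsmul hu hg, Measure.map_apply hf.of_uncurry_left hs]
    rfl
  rw [lintegral_congr_ae this]
  simp

lemma ae_linearIndependent_and_notMem_span {d : ℕ} (hd : d < Module.finrank ℝ H) :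
    ∀ᵐ W ∂(Measure.pi fun _ : Fin d => stdGaussian H), LinearIndependent ℝ W ∧
      ∀ᵐ g ∂stdGaussian H, g ∉ Submodule.span ℝ (Set.range W) := by
  filter_upwards [ae_linearIndependent d hd.le] with W hW
  refine ⟨hW, compl_mem_ae_iff.2 (stdGaussian_submodule_eq_zero fun h => ?_)⟩
  have := finrank_span_eq_card hW
  rw [h, finrank_top, Fintype.card_fin] at this
  omega

lemma ae_isUnit_residualGram {d : ℕ} (hd : d < Module.finrank ℝ H) {u : H} (hu : u ≠ 0) :
    ∀ᵐ W ∂(Measure.pi fun _ : Fin d => stdGaussian H), IsUnit (residualGram u W) := by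
  have : Nontrivial H := ⟨u, 0, hu⟩
  have hset : MeasurableSet {p : H × (Fin d → H) | IsUnit (residualGram p.1 p.2)} := by
    simp_rw [Matrix.isUnit_iff_isUnit_det, isUnit_iff_ne_zero]
    exact (isOpen_ne.preimage (continuous_residualGram d).matrix_det).measurableSet
  have hf : Measurable (Function.uncurry fun (u : H) (W : Fin d → H) =>
      IsUnit (residualGram u W)) := measurableSet_setOfPred.1 hset
  -- Invertibility is itself an invariant, with values in `Prop`, so u may be made Gaussian. Then W
  -- can be fixed first and g avoids its span.
  have hmap := map_uncurry_eq_of_invariant hf (fun R u W => by rw [residualGram_map])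
    (fun c hc u W => by
      rw [residualGram_smul, eq_iff_iff]
      simp [Matrix.isUnit_iff_isUnit_det, isUnit_iff_ne_zero, hc]) hu
  have hlift : ∀ᵐ p ∂((stdGaussian H).prod (Measure.pi fun _ : Fin d => stdGaussian H)),
      IsUnit (residualGram p.1 p.2) := by
    rw [Measure.ae_prod_iff_ae_ae hset, Measure.ae_ae_comm hset]
    filter_upwards [ae_linearIndependent_and_notMem_span hd] with W hW
    filter_upwards [hW.2] with g hg using isUnit_residualGram hW.1 hg
  have hid : MeasurableSet {q : Prop | q} := trivial
  have h1 := (ae_map_iff (p := id) hf.aemeasurable hid).2 hlift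
  rw [hmap] at h1
  exact (ae_map_iff (p := id) (hf.of_uncurry_left (x := u)).aemeasurable hid).1 h1

/-- The law of the quotient of Hotelling's statistic. -/
lemma map_projRatio {d : ℕ} (hd : d < Module.finrank ℝ H) {u : H} (hu : u ≠ 0) :
    (Measure.pi fun _ : Fin d => stdGaussian H).map (projRatio u)
      = ((chiSquared d).prod (chiSquared (Module.finrank ℝ H - d))).map
        fun p => p.1 / p.2 := by
  have : Nontrivial H := ⟨u, 0, hu⟩
  have hf : Measurable (Function.uncurry (projRatio (H := H) (d := d))) := measurable_projRatio d
  rw [← map_uncurry_eq_of_invariant (f := projRatio) hf (fun R u W => projRatio_map R u W)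
    (fun c hc u W => projRatio_smul hc u W) hu]
  ext s hs
  -- Now that the vector is random, the roles are swapped: conditionally on W, the projection is
  -- onto a fixed d-dimensional subspace.
  rw [← Measure.prod_swap, Measure.map_map hf measurable_swap,
    Measure.map_apply (hf.comp measurable_swap) hs,
    Measure.prod_apply ((hf.comp measurable_swap) hs)]
  have key : ∀ᵐ W ∂(Measure.pi fun _ : Fin d => stdGaussian H),
      stdGaussian H (Prod.mk W ⁻¹' ((Function.uncurry projRatio ∘ Prod.swap) ⁻¹' s))
        = ((chiSquared d).prod (chiSquared (Module.finrank ℝ H - d))).map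
          (fun p => p.1 / p.2) s := by
    filter_upwards [ae_linearIndependent_and_notMem_span hd] with W hW
    set V := Submodule.span ℝ (Set.range W)
    have hV : Module.finrank ℝ V = d := by
      simpa using finrank_span_eq_card hW.1
    have hV' : Module.finrank ℝ Vᗮ = Module.finrank ℝ H - d := by
      have := V.finrank_add_finrank_orthogonal
      omega
    have hlaw := map_norm_sq_starProjection V
    rw [hV, hV'] at hlaw
    rw [← hlaw, Measure.map_map (by fun_prop) (by fun_prop), Measure.map_apply (by fun_prop) hs]
    refine measure_congr ?_
    filter_upwards [hW.2] with g hg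
    refine congrArg (· ∈ s) ?_
    exact projRatio_eq hW.1 hg
  rw [lintegral_congr_ae key]
  simp

end Gaussian

/-! ### Hotelling's statistic of Gaussian vectors -/

section Hotelling

variable {d m : ℕ}

/-- The sum of the outer products of the deviations of the `b j` from their mean. -/
noncomputable def scatter (b : Fin m → EuclideanSpace ℝ (Fin d)) : Matrix (Fin d) (Fin d) ℝ :=
  ∑ j, Matrix.vecMulVec (b j - (m : ℝ)⁻¹ • ∑ l, b l).ofLp (b j - (m : ℝ)⁻¹ • ∑ l, b l).ofLp

/-- The quadratic form of the inverse of `scatter b` at `c`, times `m - 1`. -/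
noncomputable def hotelling (p : (Fin m → EuclideanSpace ℝ (Fin d)) × EuclideanSpace ℝ (Fin d)) :
    ℝ :=
  ((m : ℝ) - 1) * (p.2.ofLp ⬝ᵥ ((scatter p.1)⁻¹ *ᵥ p.2.ofLp))

/-- The sums of all `z l` but one, and a multiple of the sum of all of them. -/
noncomputable def leaveOneOut (a : ℝ) (z : Fin m → EuclideanSpace ℝ (Fin d)) :
    (Fin m → EuclideanSpace ℝ (Fin d)) × EuclideanSpace ℝ (Fin d) :=
  (fun j => ∑ l, z l - z j, (a * (√(m : ℝ))⁻¹) • ∑ l, z l)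

/-- The columns of the matrix with rows `z j`. -/
noncomputable def columns (z : Fin m → EuclideanSpace ℝ (Fin d)) (i : Fin d) :
    EuclideanSpace ℝ (Fin m) :=
  WithLp.toLp 2 fun j => z j i

/-- The unit vector with equal entries. -/
noncomputable def meanDirection (m : ℕ) : EuclideanSpace ℝ (Fin m) :=
  WithLp.toLp 2 fun _ => (√(m : ℝ))⁻¹

lemma continuous_scatter :
    Continuous (scatter : (Fin m → EuclideanSpace ℝ (Fin d)) → Matrix (Fin d) (Fin d) ℝ) := by
  refine continuous_matrix fun i j => ?_
  simp only [scatter, Matrix.sum_apply, Matrix.vecMulVec_apply]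
  fun_prop

lemma measurable_hotelling : Measurable (hotelling (m := m) (d := d)) := by
  unfold hotelling
  simp only [dotProduct_inv_mulVec]
  have h : Continuous fun p : (Fin m → EuclideanSpace ℝ (Fin d)) × EuclideanSpace ℝ (Fin d) =>
    scatter p.1 := continuous_scatter.comp continuous_fst
  have ha : Continuous fun p : (Fin m → EuclideanSpace ℝ (Fin d)) × EuclideanSpace ℝ (Fin d) =>
    p.2.ofLp := by fun_prop
  exact (h.matrix_det.measurable.inv.mul
    (ha.dotProduct (h.matrix_adjugate.matrix_mulVec ha)).measurable).const_mul _

lemma isOpen_isUnit_scatter :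
    IsOpen {p : (Fin m → EuclideanSpace ℝ (Fin d)) × EuclideanSpace ℝ (Fin d) |
      IsUnit (scatter p.1)} := by
  simp_rw [Matrix.isUnit_iff_isUnit_det, isUnit_iff_ne_zero]
  exact isOpen_ne.preimage (continuous_scatter.comp continuous_fst).matrix_det

lemma continuousOn_hotelling :
    ContinuousOn (hotelling (m := m) (d := d)) {p | IsUnit (scatter p.1)} := by
  unfold hotelling
  simp only [dotProduct_inv_mulVec]
  have h : Continuous fun p : (Fin m → EuclideanSpace ℝ (Fin d)) × EuclideanSpace ℝ (Fin d) =>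
    scatter p.1 := continuous_scatter.comp continuous_fst
  have ha : Continuous fun p : (Fin m → EuclideanSpace ℝ (Fin d)) × EuclideanSpace ℝ (Fin d) =>
    p.2.ofLp := by fun_prop
  refine continuousOn_const.mul ((h.matrix_det.continuousOn.inv₀ fun p hp => ?_).mul
    (ha.dotProduct (h.matrix_adjugate.matrix_mulVec ha)).continuousOn)
  exact ((Matrix.isUnit_iff_isUnit_det _).1 hp).ne_zero

lemma continuous_leaveOneOut : Continuous fun p :
    (Fin m → EuclideanSpace ℝ (Fin d)) × ℝ => leaveOneOut p.2 p.1 := by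
  unfold leaveOneOut
  fun_prop

lemma scatter_map (A : Matrix (Fin d) (Fin d) ℝ) (b : Fin m → EuclideanSpace ℝ (Fin d)) :
    scatter (fun j => Matrix.toEuclideanCLM (𝕜 := ℝ) A (b j)) = A * scatter b * Aᵀ := by
  simp only [scatter]
  rw [Finset.mul_sum, Finset.sum_mul]
  refine Finset.sum_congr rfl fun j _ => ?_
  rw [← map_sum, ← map_smul, ← map_sub, Matrix.ofLp_toEuclideanCLM, Matrix.mul_vecMulVec,
    Matrix.vecMulVec_mul, Matrix.vecMul_transpose]

lemma isUnit_scatter_map {A : Matrix (Fin d) (Fin d) ℝ} (hA : IsUnit A)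
    (b : Fin m → EuclideanSpace ℝ (Fin d)) :
    IsUnit (scatter fun j => Matrix.toEuclideanCLM (𝕜 := ℝ) A (b j)) ↔ IsUnit (scatter b) := by
  rw [Matrix.isUnit_iff_isUnit_det, isUnit_iff_ne_zero] at hA
  simp [scatter_map, Matrix.isUnit_iff_isUnit_det, hA]

/-- The inverse scatter matrix transforms by A⁻ᵀ and A⁻¹, which cancel the A on either side. This
removes the unknown covariance from the limit. -/
lemma hotelling_map {A : Matrix (Fin d) (Fin d) ℝ} (hA : IsUnit A)
    (b : Fin m → EuclideanSpace ℝ (Fin d)) (c : EuclideanSpace ℝ (Fin d)) :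
    hotelling (fun j => Matrix.toEuclideanCLM (𝕜 := ℝ) A (b j),
      Matrix.toEuclideanCLM (𝕜 := ℝ) A c) = hotelling (b, c) := by
  have hA' := (Matrix.isUnit_iff_isUnit_det A).1 hA
  simp only [hotelling]
  rw [scatter_map, Matrix.mul_inv_rev, Matrix.mul_inv_rev, Matrix.ofLp_toEuclideanCLM,
    ← Matrix.mulVec_mulVec, ← Matrix.mulVec_mulVec, Matrix.mulVec_mulVec _ A⁻¹ A,
    Matrix.nonsing_inv_mul _ hA', Matrix.one_mulVec, Matrix.dotProduct_mulVec,
    ← Matrix.transpose_nonsing_inv, Matrix.vecMul_transpose, Matrix.mulVec_mulVec,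
    Matrix.nonsing_inv_mul _ hA', Matrix.one_mulVec]

lemma leaveOneOut_map (A : Matrix (Fin d) (Fin d) ℝ) (a : ℝ)
    (z : Fin m → EuclideanSpace ℝ (Fin d)) :
    leaveOneOut a (fun j => Matrix.toEuclideanCLM (𝕜 := ℝ) A (z j))
      = (fun j => Matrix.toEuclideanCLM (𝕜 := ℝ) A ((leaveOneOut a z).1 j),
        Matrix.toEuclideanCLM (𝕜 := ℝ) A (leaveOneOut a z).2) := by
  simp [leaveOneOut]

lemma inner_columns_meanDirection (z : Fin m → EuclideanSpace ℝ (Fin d)) (i : Fin d) :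
    inner ℝ (columns z i) (meanDirection m) = (√(m : ℝ))⁻¹ * ∑ j, z j i := by
  simp [columns, meanDirection, PiLp.inner_apply, Finset.mul_sum]

lemma norm_meanDirection (hm : 0 < m) : ‖meanDirection m‖ ^ 2 = 1 := by
  have : (m : ℝ) ≠ 0 := by positivity
  simp [meanDirection, EuclideanSpace.real_norm_sq_eq, this]

/-- A leave-one-out sum deviates from the average of these sums by z̄ - z_j, so up to sign the
deviations are those of the data. Centring the data is removing the component of each column along
the mean direction. -/
lemma scatter_leaveOneOut (hm : 0 < m) (a : ℝ) (z : Fin m → EuclideanSpace ℝ (Fin d)) :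
    scatter (leaveOneOut a z).1 = residualGram (meanDirection m) (columns z) := by
  have hm0 : (m : ℝ) ≠ 0 := by positivity
  have hdev : ∀ j, (leaveOneOut a z).1 j - (m : ℝ)⁻¹ • ∑ l, (leaveOneOut a z).1 l
      = (m : ℝ)⁻¹ • ∑ l, z l - z j := by
    intro j
    simp only [leaveOneOut, Finset.sum_sub_distrib, Finset.sum_const, Finset.card_univ,
      Fintype.card_fin, smul_sub, ← Nat.cast_smul_eq_nsmul ℝ, smul_smul, inv_mul_cancel₀ hm0,
      one_smul]
    abel
  ext i k
  have hms : (√(m : ℝ))⁻¹ * (√(m : ℝ))⁻¹ = (m : ℝ)⁻¹ := by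
    rw [← mul_inv, Real.mul_self_sqrt (by positivity)]
  simp only [scatter, hdev, residualGram, norm_meanDirection hm, inner_columns_meanDirection,
    one_smul, Matrix.sub_apply, Matrix.gram_apply, Matrix.vecMulVec_apply, Matrix.sum_apply]
  have h1 : inner ℝ (columns z i) (columns z k) = ∑ j, z j i * z j k := by
    simp [columns, PiLp.inner_apply, mul_comm]
  rw [h1]
  rw [mul_mul_mul_comm, hms]
  simp only [WithLp.ofLp_sub, WithLp.ofLp_smul, WithLp.ofLp_sum, Pi.sub_apply, Pi.smul_apply,
    Finset.sum_apply, smul_eq_mul]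
  set x := ∑ j, z j i
  set y := ∑ j, z j k
  have h3 : ∀ j, ((m : ℝ)⁻¹ * x - z j i) * ((m : ℝ)⁻¹ * y - z j k)
      = (m : ℝ)⁻¹ * x * ((m : ℝ)⁻¹ * y) - (m : ℝ)⁻¹ * x * z j k - (m : ℝ)⁻¹ * y * z j i
        + z j i * z j k := fun j => by ring
  simp only [h3, Finset.sum_add_distrib, Finset.sum_sub_distrib, ← Finset.mul_sum,
    Finset.sum_const, Finset.card_univ, Fintype.card_fin, nsmul_eq_mul]
  change _ - _ * y - _ * x + _ = _
  field_simp
  ring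

lemma hotelling_leaveOneOut (hm : 0 < m) (z : Fin m → EuclideanSpace ℝ (Fin d)) :
    hotelling (leaveOneOut 1 z) = ((m : ℝ) - 1) * projRatio (meanDirection m) (columns z) := by
  have h : (leaveOneOut 1 z).2.ofLp = fun i => inner ℝ (columns z i) (meanDirection m) := by
    ext i
    rw [inner_columns_meanDirection]
    simp [leaveOneOut]
  rw [hotelling, scatter_leaveOneOut hm, h, projRatio]

/-- Transposing a matrix of independent standard normal entries: both characteristic functions are
exp(-½ ∑ t_ij²), summed in either order. -/
lemma map_columns :
    (Measure.pi fun _ : Fin m => stdGaussian (EuclideanSpace ℝ (Fin d))).map columns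
      = Measure.pi fun _ : Fin d => stdGaussian (EuclideanSpace ℝ (Fin m)) := by
  have hc : Measurable (columns (m := m) (d := d)) := by
    unfold columns; fun_prop
  have : IsProbabilityMeasure ((Measure.pi fun _ : Fin m =>
    stdGaussian (EuclideanSpace ℝ (Fin d))).map columns) :=
      Measure.isProbabilityMeasure_map hc.aemeasurable
  refine charFun_eq_pi_iff.1 fun t => ?_
  set s : PiLp 2 (fun _ : Fin m => EuclideanSpace ℝ (Fin d)) :=
    WithLp.toLp 2 fun j => WithLp.toLp 2 fun i => t i j with hs
  have h : charFun (((Measure.pi fun _ : Fin m =>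
      stdGaussian (EuclideanSpace ℝ (Fin d))).map columns).map (WithLp.toLp 2)) t
      = charFun ((Measure.pi fun _ : Fin m =>
        stdGaussian (EuclideanSpace ℝ (Fin d))).map (WithLp.toLp 2)) s := by
    rw [charFun_apply, charFun_apply, Measure.map_map (by fun_prop) hc,
      integral_map (by fun_prop) (by fun_prop), integral_map (by fun_prop) (by fun_prop)]
    congr 1
    ext z
    congr 3
    simp only [PiLp.inner_apply, Function.comp_apply, columns, hs]
    exact Finset.sum_comm
  rw [h, charFun_pi]
  simp only [charFun_stdGaussian, ← Complex.exp_sum]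
  congr 1
  simp only [← Complex.ofReal_pow, EuclideanSpace.real_norm_sq_eq, hs]
  push_cast
  simp only [← Finset.sum_div, Finset.sum_neg_distrib]
  rw [Finset.sum_comm]

variable {A : Matrix (Fin d) (Fin d) ℝ}

lemma ae_isUnit_scatter_leaveOneOut (hm : d < m) (hA : IsUnit A) :
    ∀ᵐ z ∂(Measure.pi fun _ : Fin m => stdGaussian (EuclideanSpace ℝ (Fin d))),
      IsUnit (scatter
        (leaveOneOut 1 fun j => Matrix.toEuclideanCLM (𝕜 := ℝ) A (z j)).1) := by
  have hm0 : 0 < m := by omega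
  have hu : meanDirection m ≠ 0 := by
    intro h
    simpa [h] using norm_meanDirection hm0
  have h := ae_isUnit_residualGram (d := d) (by simpa using hm) hu
  rw [← map_columns] at h
  have hc : Measurable (columns (m := m) (d := d)) := by
    unfold columns; fun_prop
  filter_upwards [ae_of_ae_map hc.aemeasurable h] with z hz
  rwa [leaveOneOut_map, isUnit_scatter_map hA, scatter_leaveOneOut hm0]

/-- Hotelling's statistic has a scaled `F` distribution. -/
lemma map_hotelling_leaveOneOut (hd : 0 < d) (hm : d < m) (hA : IsUnit A) :
    (Measure.pi fun _ : Fin m => stdGaussian (EuclideanSpace ℝ (Fin d))).map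
        (fun z => hotelling
          (leaveOneOut 1 fun j => Matrix.toEuclideanCLM (𝕜 := ℝ) A (z j)))
      = (fDist d (m - d)).map fun x => (d : ℝ) * ((m : ℝ) - 1) / ((m : ℝ) - d) * x := by
  have hm0 : 0 < m := by omega
  have hu : meanDirection m ≠ 0 := by
    intro h
    simpa [h] using norm_meanDirection hm0
  have hc : Measurable (columns (m := m) (d := d)) := by
    unfold columns; fun_prop
  have hfun : (fun z : Fin m → EuclideanSpace ℝ (Fin d) => hotelling
      (leaveOneOut 1 fun j => Matrix.toEuclideanCLM (𝕜 := ℝ) A (z j)))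
      = (fun x => ((m : ℝ) - 1) * x) ∘ projRatio (meanDirection m) ∘ columns := by
    ext z
    rw [leaveOneOut_map, hotelling_map hA, hotelling_leaveOneOut hm0]
    rfl
  have hp : Measurable (projRatio (d := d) (meanDirection m)) :=
    (measurable_projRatio d).comp measurable_prodMk_left
  rw [hfun, ← Measure.map_map (by fun_prop) (by fun_prop), ← Measure.map_map hp hc, map_columns,
    map_projRatio (by simpa using hm) hu, finrank_euclideanSpace_fin, fDist,
    Measure.map_map (by fun_prop) (by fun_prop), Measure.map_map (by fun_prop) (by fun_prop)]
  -- The constant is m - 1 = d(m - 1)/(m - d) · (m - d)/d, the last factor undoing the normalization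
  -- of U/V in the F distribution.
  congr 1
  ext p
  have h1 : (d : ℝ) ≠ 0 := by positivity
  have h2 : (m : ℝ) - d ≠ 0 := by
    have : (d : ℝ) < m := by exact_mod_cast hm
    linarith
  simp only [Function.comp_apply, Nat.cast_sub hm.le]
  field_simp

end Hotelling

/-! ### Portmanteau and continuous mapping on an open set -/

section Mapping

variable {Ω Ω' E F : Type*} [MeasurableSpace Ω] [MeasurableSpace Ω'] {μ : Measure Ω}
  [IsProbabilityMeasure μ] {ν : Measure Ω'} [IsProbabilityMeasure ν]
  [TopologicalSpace E] [HasOuterApproxClosed E] [MeasurableSpace E] [BorelSpace E]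
  [TopologicalSpace F] [MeasurableSpace F] [BorelSpace F]

lemma le_liminf_measure_of_tendstoInDistribution {X : ℕ → Ω → E} {Z : Ω' → E}
    (h : TendstoInDistribution X atTop Z (fun _ => μ) ν) {G : Set E} (hG : IsOpen G) :
    ν {x | Z x ∈ G} ≤ liminf (fun n => μ {ω | X n ω ∈ G}) atTop := by
  have := ProbabilityMeasure.le_liminf_measure_open_of_tendsto h.tendsto hG
  simp only [ProbabilityMeasure.coe_mk] at this
  rw [Measure.map_apply_of_aemeasurable h.aemeasurable_limit hG.measurableSet] at this
  simp only [fun n => Measure.map_apply_of_aemeasurable (h.forall_aemeasurable n)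
    hG.measurableSet] at this
  exact this

lemma tendsto_measure_one_of_tendstoInDistribution {X : ℕ → Ω → E} {Z : Ω' → E}
    (h : TendstoInDistribution X atTop Z (fun _ => μ) ν) {U : Set E} (hU : IsOpen U)
    (hZU : ∀ᵐ x ∂ν, Z x ∈ U) : Tendsto (fun n => μ {ω | X n ω ∈ U}) atTop (𝓝 1) := by
  refine tendsto_of_le_liminf_of_limsup_le ?_ ?_
  · refine le_trans (le_of_eq ?_) (le_liminf_measure_of_tendstoInDistribution h hU)
    exact ((measure_congr (eventuallyEq_set.2 (hZU.mono fun x hx =>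
      ⟨fun _ => trivial, fun _ => hx⟩))).trans measure_univ).symm
  · exact limsup_le_of_le (by isBoundedDefault) (Eventually.of_forall fun n => prob_le_one)

/-- The continuous mapping theorem for a function that is continuous on an open set of full
measure under the limit law. -/
lemma tendstoInDistribution_comp_of_continuousOn {X : ℕ → Ω → E} {Z : Ω' → E}
    (h : TendstoInDistribution X atTop Z (fun _ => μ) ν) {U : Set E} (hU : IsOpen U)
    (hZU : ∀ᵐ x ∂ν, Z x ∈ U) {g : E → F} (hg : Measurable g) (hgU : ContinuousOn g U) :
    TendstoInDistribution (fun n ω => g (X n ω)) atTop (fun x => g (Z x)) (fun _ => μ) ν where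
  forall_aemeasurable n := hg.comp_aemeasurable (h.forall_aemeasurable n)
  aemeasurable_limit := hg.comp_aemeasurable h.aemeasurable_limit
  tendsto := by
    refine tendsto_of_forall_isOpen_le_liminf' fun G hG => ?_
    simp only [ProbabilityMeasure.coe_mk]
    have hgZ : AEMeasurable (fun x => g (Z x)) ν := hg.comp_aemeasurable h.aemeasurable_limit
    have hgX : ∀ n, AEMeasurable (fun ω => g (X n ω)) μ := fun n =>
      hg.comp_aemeasurable (h.forall_aemeasurable n)
    rw [Measure.map_apply_of_aemeasurable hgZ hG.measurableSet]
    simp only [fun n => Measure.map_apply_of_aemeasurable (hgX n) hG.measurableSet]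
    -- Discarding the complement of U, null in the limit, leaves an open set, to which the
    -- portmanteau inequality applies.
    have hopen : IsOpen (U ∩ g ⁻¹' G) := hgU.isOpen_inter_preimage hU hG
    calc ν ((fun x => g (Z x)) ⁻¹' G) = ν {x | Z x ∈ U ∩ g ⁻¹' G} := by
          refine measure_congr ?_
          filter_upwards [hZU] with x hx
          exact propext ⟨fun hxG => ⟨hx, hxG⟩, fun hxG => hxG.2⟩
      _ ≤ liminf (fun n => μ {ω | X n ω ∈ U ∩ g ⁻¹' G}) atTop :=
          le_liminf_measure_of_tendstoInDistribution h hopen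
      _ ≤ _ := liminf_le_liminf (Eventually.of_forall fun n =>
          measure_mono fun ω hω => hω.2)

end Mapping

/-! ### Central limit theorem for block sums -/

section CentralLimit

variable {𝓧 E : Type*} [MeasurableSpace 𝓧] {P : Measure 𝓧} [IsProbabilityMeasure P]
  [NormedAddCommGroup E] [InnerProductSpace ℝ E] [FiniteDimensional ℝ E] [MeasurableSpace E]
  [BorelSpace E] {ψ : 𝓧 → E}

/-- Cramér–Wold: for t ≠ 0 this is the scalar central limit theorem for the projection onto t/‖t‖,
evaluated at ‖t‖. -/
lemma tendsto_charFun_inv_sqrt_smul_pow (hψ : Measurable ψ)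
    (h0 : ∀ t, ∫ x, inner ℝ (ψ x) t ∂P = 0) (h1 : ∀ t, ∫ x, inner ℝ (ψ x) t ^ 2 ∂P = ‖t‖ ^ 2)
    (t : E) :
    Tendsto (fun k : ℕ => charFun (P.map ψ) ((√(k : ℝ))⁻¹ • t) ^ k) atTop
      (𝓝 (Complex.exp (-(‖t‖ : ℂ) ^ 2 / 2))) := by
  have : IsProbabilityMeasure (P.map ψ) := Measure.isProbabilityMeasure_map hψ.aemeasurable
  rcases eq_or_ne t 0 with rfl | ht
  · simp
  have ht' : ‖t‖ ≠ 0 := norm_ne_zero_iff.2 ht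
  set v := ‖t‖⁻¹ • t with hv
  have hX : Measurable fun x => inner ℝ (ψ x) v := by fun_prop
  have hlim := tendsto_charFun_inv_sqrt_mul_pow (P := P) (X := fun x => inner ℝ (ψ x) v)
    hX.aemeasurable (h0 v) (by
      simp only [Pi.pow_apply]
      rw [h1, hv, norm_smul, norm_inv, norm_norm, inv_mul_cancel₀ ht', one_pow]) ‖t‖
  refine hlim.congr fun k => ?_
  congr 1
  rw [charFun_apply, charFun_apply, integral_map (by fun_prop) (by fun_prop),
    integral_map (by fun_prop) (by fun_prop)]
  congr 1
  ext x
  congr 3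
  simp only [hv, real_inner_smul_right, RCLike.inner_apply, conj_trivial]
  field_simp

/-- The vector of the normalized sums of `ψ (x i)` over `m` blocks of length `k`. -/
noncomputable def blockSums (ψ : 𝓧 → E) {k m N : ℕ} (e : Fin k × Fin m ≃ Fin N)
    (x : Fin N → 𝓧) (j : Fin m) : E :=
  (√(k : ℝ))⁻¹ • ∑ l, ψ (x (e (l, j)))

lemma measurable_blockSums (hψ : Measurable ψ) {k m N : ℕ} (e : Fin k × Fin m ≃ Fin N) :
    Measurable (blockSums ψ e) := by
  unfold blockSums
  fun_prop

lemma charFun_map_blockSums (hψ : Measurable ψ) {k m N : ℕ} (e : Fin k × Fin m ≃ Fin N)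
    (t : PiLp 2 fun _ : Fin m => E) :
    charFun (((Measure.pi fun _ : Fin N => P).map (blockSums ψ e)).map (WithLp.toLp 2)) t
      = ∏ j, charFun (P.map ψ) ((√(k : ℝ))⁻¹ • t j) ^ k := by
  rw [Measure.map_map (by fun_prop) (measurable_blockSums hψ e), charFun_apply,
    integral_map ((by fun_prop : Measurable (WithLp.toLp 2)).comp
      (measurable_blockSums hψ e)).aemeasurable (by fun_prop)]
  have h : ∀ x : Fin N → 𝓧, Complex.exp
      ((inner ℝ ((WithLp.toLp 2 ∘ blockSums ψ e) x) t : ℝ) * Complex.I)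
      = ∏ i, Complex.exp ((inner ℝ (ψ (x i)) ((√(k : ℝ))⁻¹ • t (e.symm i).2) : ℝ)
        * Complex.I) := by
    intro x
    rw [← Complex.exp_sum, ← Finset.sum_mul, ← Complex.ofReal_sum]
    congr 3
    rw [← e.sum_comp, Fintype.sum_prod_type_right]
    simp only [PiLp.inner_apply, Function.comp_apply, blockSums, Equiv.symm_apply_apply,
      real_inner_smul_left, real_inner_smul_right, sum_inner, Finset.mul_sum]
  simp only [h]
  rw [integral_fintype_prod_eq_prod (f := fun i x => Complex.exp
    ((inner ℝ (ψ x) ((√(k : ℝ))⁻¹ • t (e.symm i).2) : ℝ) * Complex.I)),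
    ← e.prod_comp, Fintype.prod_prod_type_right]
  refine Finset.prod_congr rfl fun j _ => ?_
  simp only [Equiv.symm_apply_apply, Finset.prod_const, Finset.card_univ, Fintype.card_fin]
  rw [charFun_apply, integral_map (by fun_prop) (by fun_prop)]

/-- The central limit theorem for block sums of independent, identically distributed vectors with
identity covariance matrix. -/
lemma tendstoInDistribution_blockSums {Ω : Type*} [MeasurableSpace Ω] {μ : Measure Ω}
    [IsProbabilityMeasure μ] (hψ : Measurable ψ)
    (h0 : ∀ t, ∫ x, inner ℝ (ψ x) t ∂P = 0) (h1 : ∀ t, ∫ x, inner ℝ (ψ x) t ^ 2 ∂P = ‖t‖ ^ 2)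
    {m : ℕ} {k N : ℕ → ℕ} (hk : Tendsto k atTop atTop) (e : ∀ n, Fin (k n) × Fin m ≃ Fin (N n))
    (Y : ∀ n, Ω → Fin (N n) → 𝓧) (hY : ∀ n, HasLaw (Y n) (Measure.pi fun _ => P) μ) :
    TendstoInDistribution (fun n ω => blockSums ψ (e n) (Y n ω)) atTop id (fun _ => μ)
      (Measure.pi fun _ : Fin m => stdGaussian E) := by
  have hmeas : ∀ n, AEMeasurable (fun ω => blockSums ψ (e n) (Y n ω)) μ := fun n =>
    (measurable_blockSums hψ (e n)).comp_aemeasurable (hY n).aemeasurable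
  have key : TendstoInDistribution
      (fun n ω => (WithLp.toLp 2 (blockSums ψ (e n) (Y n ω)) : PiLp 2 fun _ : Fin m => E)) atTop
      (WithLp.toLp 2) (fun _ => μ) (Measure.pi fun _ : Fin m => stdGaussian E) := by
    refine ⟨fun n => (by fun_prop : Measurable (WithLp.toLp 2)).comp_aemeasurable (hmeas n),
      by fun_prop, ?_⟩
    refine ProbabilityMeasure.tendsto_iff_tendsto_charFun.2 fun t => ?_
    simp only [ProbabilityMeasure.coe_mk]
    have hlaw : ∀ n, μ.map (fun ω => (WithLp.toLp 2 (blockSums ψ (e n) (Y n ω)) :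
        PiLp 2 fun _ : Fin m => E))
        = ((Measure.pi fun _ : Fin (N n) => P).map (blockSums ψ (e n))).map (WithLp.toLp 2) := by
      intro n
      rw [← (hY n).map_eq, AEMeasurable.map_map_of_aemeasurable
        (measurable_blockSums hψ (e n)).aemeasurable (hY n).aemeasurable,
        AEMeasurable.map_map_of_aemeasurable (by fun_prop)
          ((measurable_blockSums hψ (e n)).comp_aemeasurable (hY n).aemeasurable)]
      rfl
    simp only [hlaw, charFun_map_blockSums hψ, charFun_pi, charFun_stdGaussian]
    exact tendsto_finsetProd _ fun j _ =>
      (tendsto_charFun_inv_sqrt_smul_pow hψ h0 h1 (t j)).comp hk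
  exact key.continuous_comp (g := WithLp.ofLp) (PiLp.continuous_ofLp 2 _)

end CentralLimit

/-! ### Sampling without replacement from i.i.d. data -/

section Sampling

variable {𝓧 : Type*} [MeasurableSpace 𝓧] {P : Measure 𝓧} [IsProbabilityMeasure P] {N n : ℕ}

lemma hasLaw_pi_comp_injective {f : Fin N → Fin n} (hf : Function.Injective f) :
    HasLaw (fun (x : Fin n → 𝓧) i => x (f i)) (Measure.pi fun _ => P)
      (Measure.pi fun _ : Fin n => P) := by
  have h : iIndepFun (fun (i : Fin n) (x : Fin n → 𝓧) => x i) (Measure.pi fun _ => P) :=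
    iIndepFun_pi (X := fun (_ : Fin n) (y : 𝓧) => y) fun _ => aemeasurable_id
  exact (h.precomp hf).hasLaw_pi fun i =>
    (measurePreserving_eval (fun _ : Fin n => P) (f i)).hasLaw

lemma measurable_sample :
    Measurable fun p : (Fin N → Fin n) × (Fin n → 𝓧) => fun i => p.2 (p.1 i) :=
  measurable_from_prod_countable_right fun f => measurable_pi_lambda _ fun i =>
    measurable_pi_apply (f i)

variable {ν : Measure (Fin N → Fin n)} [IsProbabilityMeasure ν]

/-- Given any injective choice of indices, the chosen observations are i.i.d. with law P; this
conditional law does not depend on the choice. -/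
lemma hasLaw_sample (hν : ∀ᵐ f ∂ν, Function.Injective f) :
    HasLaw (fun p : (Fin N → Fin n) × (Fin n → 𝓧) => fun i => p.2 (p.1 i))
      (Measure.pi fun _ => P) (ν.prod (Measure.pi fun _ => P)) where
  aemeasurable := measurable_sample.aemeasurable
  map_eq := by
    ext s hs
    rw [Measure.map_apply measurable_sample hs, Measure.prod_apply (measurable_sample hs)]
    have : ∀ᵐ f ∂ν, (Measure.pi fun _ : Fin n => P) (Prod.mk f ⁻¹'
        ((fun p : (Fin N → Fin n) × (Fin n → 𝓧) => fun i => p.2 (p.1 i)) ⁻¹' s))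
        = (Measure.pi fun _ : Fin N => P) s := by
      filter_upwards [hν] with f hf
      rw [← (hasLaw_pi_comp_injective (P := P) hf).map_eq, Measure.map_apply (by fun_prop) hs]
      rfl
    rw [lintegral_congr_ae this]
    simp

variable {E : Type*} [NormedAddCommGroup E] [MeasurableSpace E] [BorelSpace E]
  [SecondCountableTopology E] {φ : 𝓧 → E}

/-- For an injective choice f, the difference of the sums is the sum over the n - N indices not
chosen, each contributing at most E‖φ‖. -/
lemma lintegral_enorm_sum_sub_sum_sample_le (hφ : Measurable φ)
    (hν : ∀ᵐ f ∂ν, Function.Injective f) :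
    ∫⁻ p, ‖∑ i, φ (p.2 i) - ∑ i, φ (p.2 (p.1 i))‖ₑ ∂(ν.prod (Measure.pi fun _ : Fin n => P))
      ≤ (n - N : ℕ) * ∫⁻ x, ‖φ x‖ₑ ∂P := by
  have hmeas : Measurable fun p : (Fin N → Fin n) × (Fin n → 𝓧) =>
      ‖∑ i, φ (p.2 i) - ∑ i, φ (p.2 (p.1 i))‖ₑ := by
    refine Measurable.enorm (Measurable.sub (by fun_prop) ?_)
    have : Measurable fun x : Fin N → 𝓧 => ∑ i, φ (x i) := by fun_prop
    exact this.comp measurable_sample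
  rw [lintegral_prod _ hmeas.aemeasurable]
  have key : ∀ᵐ f ∂ν, ∫⁻ x, ‖∑ i, φ (x i) - ∑ i, φ (x (f i))‖ₑ ∂(Measure.pi fun _ : Fin n => P)
      ≤ (n - N : ℕ) * ∫⁻ x, ‖φ x‖ₑ ∂P := by
    filter_upwards [hν] with f hf
    have hrest : ∀ x : Fin n → 𝓧, ∑ i, φ (x i) - ∑ i, φ (x (f i))
        = ∑ i ∈ (Finset.univ.image f)ᶜ, φ (x i) := by
      intro x
      rw [sub_eq_iff_eq_add, ← Finset.sum_compl_add_sum (Finset.univ.image f),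
        Finset.sum_image fun i _ j _ h => hf h]
    have hone : ∀ i : Fin n, ∫⁻ x, ‖φ (x i)‖ₑ ∂(Measure.pi fun _ : Fin n => P)
        = ∫⁻ x, ‖φ x‖ₑ ∂P := fun i =>
      (measurePreserving_eval (fun _ : Fin n => P) i).lintegral_comp hφ.enorm
    calc ∫⁻ x, ‖∑ i, φ (x i) - ∑ i, φ (x (f i))‖ₑ ∂(Measure.pi fun _ : Fin n => P)
        ≤ ∫⁻ x, ∑ i ∈ (Finset.univ.image f)ᶜ, ‖φ (x i)‖ₑ ∂(Measure.pi fun _ : Fin n => P) := by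
          refine lintegral_mono fun x => ?_
          rw [hrest]
          exact enorm_sum_le _ _
      _ = (n - N : ℕ) * ∫⁻ x, ‖φ x‖ₑ ∂P := by
          rw [lintegral_finsetSum _ fun i _ => by fun_prop]
          simp only [hone, Finset.sum_const, Finset.card_compl, Fintype.card_fin,
            Finset.card_image_of_injective _ hf, Finset.card_univ, nsmul_eq_mul]
  calc _ ≤ ∫⁻ _, (n - N : ℕ) * ∫⁻ x, ‖φ x‖ₑ ∂P ∂ν := lintegral_mono_ae key
    _ = _ := by simp

lemma ae_injective_uniformOn (hN : N ≤ n) :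
    IsProbabilityMeasure (uniformOn {f : Fin N → Fin n | Function.Injective f}) ∧
      ∀ᵐ f ∂(uniformOn {f : Fin N → Fin n | Function.Injective f}), Function.Injective f :=
  ⟨isProbabilityMeasure_uniformOn (Set.toFinite _) ⟨Fin.castLE hN, Fin.castLE_injective hN⟩,
    ae_cond_mem (Set.toFinite _).measurableSet⟩

end Sampling

/-! ### Convergence to zero in measure -/

section ConvergenceInMeasure

variable {Ω E : Type*} [MeasurableSpace Ω] {μ : Measure Ω} [NormedAddCommGroup E]

lemma tendstoInMeasure_zero_iff {f : ℕ → Ω → E} :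
    TendstoInMeasure μ f atTop (fun _ => 0)
      ↔ ∀ ε, 0 < ε → Tendsto (fun n => μ {ω | ε ≤ ‖f n ω‖}) atTop (𝓝 0) := by
  simp [tendstoInMeasure_iff_norm]

lemma tendstoInMeasure_zero_add {f g : ℕ → Ω → E}
    (hf : TendstoInMeasure μ f atTop fun _ => 0) (hg : TendstoInMeasure μ g atTop fun _ => 0) :
    TendstoInMeasure μ (fun n ω => f n ω + g n ω) atTop fun _ => 0 := by
  rw [tendstoInMeasure_zero_iff] at *
  intro ε hε
  have h := (hf (ε / 2) (by positivity)).add (hg (ε / 2) (by positivity))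
  rw [add_zero] at h
  refine tendsto_of_tendsto_of_tendsto_of_le_of_le tendsto_const_nhds h (fun _ => zero_le)
    fun n => (measure_mono ?_).trans (measure_union_le _ _)
  intro ω hω
  simp only [Set.mem_union, Set.mem_ofPred_eq] at hω ⊢
  by_contra! hcon
  have := norm_add_le (f n ω) (g n ω)
  linarith

lemma tendstoInMeasure_zero_const_smul [NormedSpace ℝ E] (c : ℝ) {f : ℕ → Ω → E}
    (hf : TendstoInMeasure μ f atTop fun _ => 0) :
    TendstoInMeasure μ (fun n ω => c • f n ω) atTop fun _ => 0 := by
  rw [tendstoInMeasure_zero_iff] at *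
  intro ε hε
  refine tendsto_of_tendsto_of_tendsto_of_le_of_le tendsto_const_nhds
    (hf (ε / (|c| + 1)) (by positivity)) (fun _ => zero_le) fun n => measure_mono ?_
  intro ω hω
  simp only [Set.mem_ofPred_eq, norm_smul, Real.norm_eq_abs] at hω ⊢
  rw [div_le_iff₀ (by positivity)]
  nlinarith [norm_nonneg (f n ω)]

lemma tendstoInMeasure_zero_pi_prod {ι F : Type*} [Fintype ι] [NormedAddCommGroup F]
    {f : ℕ → Ω → (ι → E) × F}
    (hf : ∀ j, TendstoInMeasure μ (fun n ω => (f n ω).1 j) atTop fun _ => 0)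
    (hg : TendstoInMeasure μ (fun n ω => (f n ω).2) atTop fun _ => 0) :
    TendstoInMeasure μ f atTop fun _ => 0 := by
  rw [tendstoInMeasure_zero_iff] at *
  intro ε hε
  have h := (tendsto_finsetSum Finset.univ fun j _ =>
    tendstoInMeasure_zero_iff.1 (hf j) ε hε).add (hg ε hε)
  rw [Finset.sum_const_zero, add_zero] at h
  refine tendsto_of_tendsto_of_tendsto_of_le_of_le tendsto_const_nhds h (fun _ => zero_le)
    fun n => (measure_mono ?_).trans ((measure_union_le
      (⋃ j, {ω | ε ≤ ‖(f n ω).1 j‖}) {ω | ε ≤ ‖(f n ω).2‖}).trans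
      (add_le_add_left (measure_iUnion_fintype_le μ _) _))
  intro ω hω
  simp only [Set.mem_union, Set.mem_ofPred_eq, Set.mem_iUnion] at hω ⊢
  by_contra! hcon
  have : ‖f n ω‖ < ε := by
    rw [Prod.norm_def, max_lt_iff, pi_norm_lt_iff hε]
    exact hcon
  linarith

end ConvergenceInMeasure

/-! ### The remainder of the linear approximation -/

section Remainder

variable {𝓧 E : Type*} [MeasurableSpace 𝓧] {P : Measure 𝓧}
  [NormedAddCommGroup E] [NormedSpace ℝ E] [MeasurableSpace E] [BorelSpace E]
  [SecondCountableTopology E]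

/-- The error of the linear approximation of the rescaled estimate. -/
noncomputable def remainder (t : (n : ℕ) → (Fin n → 𝓧) → E) (β₀ : E) (φ : 𝓧 → E) (n : ℕ)
    (x : Fin n → 𝓧) : E :=
  √(n : ℝ) • (t n x - β₀) - √(n : ℝ) • ((n : ℝ)⁻¹ • ∑ i : Fin n, φ (x i))

variable {t : (n : ℕ) → (Fin n → 𝓧) → E} {β₀ : E} {φ : 𝓧 → E}

lemma measurable_remainder (ht : ∀ n, Measurable (t n)) (hφ : Measurable φ) (n : ℕ) :
    Measurable (remainder t β₀ φ n) := by
  have := ht n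
  unfold remainder
  fun_prop

/-- Smallness of the remainder involves only the law of the sample, so it passes from the original
data to any i.i.d. samples whose sizes tend to infinity, in particular to the jackknife subsamples.
-/
lemma tendstoInMeasure_remainder {Ω : Type*} [MeasurableSpace Ω] {μ : Measure Ω}
    (ht : ∀ n, Measurable (t n)) (hφ : Measurable φ)
    {X : ∀ n, Ω → Fin n → 𝓧} (hX : ∀ n, HasLaw (X n) (Measure.pi fun _ => P) μ)
    (h : TendstoInMeasure μ (fun n ω => remainder t β₀ φ n (X n ω)) atTop fun _ => 0)
    {M : ℕ → ℕ} (hM : Tendsto M atTop atTop) {Y : ∀ n, Ω → Fin (M n) → 𝓧}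
    (hY : ∀ n, HasLaw (Y n) (Measure.pi fun _ => P) μ) :
    TendstoInMeasure μ (fun n ω => remainder t β₀ φ (M n) (Y n ω)) atTop fun _ => 0 := by
  rw [tendstoInMeasure_zero_iff] at *
  intro ε hε
  refine ((h ε hε).comp hM).congr fun n => ?_
  have hset : MeasurableSet {x | ε ≤ ‖remainder t β₀ φ (M n) x‖} :=
    measurableSet_le measurable_const (measurable_remainder ht hφ (M n)).norm
  rw [Function.comp_apply, (hX (M n)).measure_eq hset, (hY n).measure_eq hset]

end Remainder

/-! ### Combinatorics of the blocks -/

section Blocks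

/-- The position in the sample of the `l`-th observation of the `j`-th block. -/
def blockEquiv (m n : ℕ) : Fin (blockCount m n) × Fin m ≃ Fin (usedCount m n) :=
  finProdFinEquiv.trans (finCongr (mul_comm _ _))

lemma blockEquiv_mod (m n : ℕ) (p : Fin (blockCount m n) × Fin m) :
    (blockEquiv m n p : ℕ) % m = p.2 := by
  change ((p.2 : ℕ) + m * p.1) % m = p.2
  rw [Nat.add_mul_mod_self_left, Nat.mod_eq_of_lt p.2.2]

lemma sum_keptPositions {G : Type*} [AddCommGroup G] (m n : ℕ) (j : Fin m)
    (f : Fin (usedCount m n) → G) :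
    ∑ i ∈ keptPositions m (usedCount m n) j, f i
      = ∑ i, f i - ∑ l, f (blockEquiv m n (l, j)) := by
  have h := Finset.sum_filter_add_sum_filter_not Finset.univ
    (fun i : Fin (usedCount m n) => (i : ℕ) % m = j) f
  have hj : ∑ i ∈ Finset.univ.filter (fun i : Fin (usedCount m n) => (i : ℕ) % m = j), f i = ∑ l, f (blockEquiv m n (l, j)) := by
    rw [Finset.sum_filter, ← (blockEquiv m n).sum_comp, Fintype.sum_prod_type]
    simp only [blockEquiv_mod, Fin.val_inj]
    simp
  rw [← h, hj, keptPositions]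
  abel

lemma card_keptPositions {m : ℕ} (n : ℕ) (j : Fin m) :
    (keptPositions m (usedCount m n) j).card = (m - 1) * blockCount m n := by
  -- Counting is summing the constant 1, taken in ℤ because the formula subtracts.
  have h := sum_keptPositions m n j (fun _ => (1 : ℤ))
  simp only [Finset.sum_const, Finset.card_univ, Fintype.card_fin, nsmul_eq_mul, mul_one] at h
  have hm : 1 ≤ m := Fin.pos j
  zify [hm]
  rw [h, usedCount]
  push_cast
  ring

lemma sum_orderEmbOfFin {G : Type*} [AddCommMonoid G] {N : ℕ} (s : Finset (Fin N))
    (f : Fin N → G) : ∑ i, f (s.orderEmbOfFin rfl i) = ∑ i ∈ s, f i := by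
  conv_rhs => rw [← s.map_orderEmbOfFin_univ rfl]
  rw [Finset.sum_map]
  rfl

lemma usedCount_le (m n : ℕ) : usedCount m n ≤ n := Nat.mul_div_le n m

lemma lt_usedCount_add {m : ℕ} (hm : 0 < m) (n : ℕ) : n < usedCount m n + m := by
  have := Nat.div_add_mod n m
  have := Nat.mod_lt n hm
  simp only [usedCount, blockCount]
  omega

lemma tendsto_blockCount {m : ℕ} (hm : 0 < m) : Tendsto (blockCount m) atTop atTop :=
  Nat.tendsto_div_const_atTop hm.ne'

lemma tendsto_usedCount_div {m : ℕ} (hm : 0 < m) :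
    Tendsto (fun n : ℕ => √((usedCount m n : ℝ) / n)) atTop (𝓝 1) := by
  have h : Tendsto (fun n : ℕ => (usedCount m n : ℝ) / n) atTop (𝓝 1) := by
    have hlow : Tendsto (fun n : ℕ => 1 - (m : ℝ) / n) atTop (𝓝 1) := by
      simpa using (tendsto_const_div_atTop_nhds_zero_nat (m : ℝ)).const_sub 1
    refine tendsto_of_tendsto_of_tendsto_of_le_of_le' hlow tendsto_const_nhds ?_ ?_
    · filter_upwards [eventually_gt_atTop 0] with n hn
      have hn' : (0 : ℝ) < n := by exact_mod_cast hn
      have : (n : ℝ) < usedCount m n + m := by exact_mod_cast lt_usedCount_add hm n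
      rw [le_div_iff₀ hn', sub_mul, div_mul_cancel₀ _ hn'.ne']
      linarith
    · exact Eventually.of_forall fun n => div_le_one_of_le₀
        (by exact_mod_cast usedCount_le m n) (by positivity)
  simpa using h.sqrt

end Blocks

/-! ### The statistic in terms of rescaled errors -/

section Rescaling

variable {𝓧 : Type*} {d : ℕ} (t : (n : ℕ) → (Fin n → 𝓧) → EuclideanSpace ℝ (Fin d)) (m n : ℕ)
  (β₀ : EuclideanSpace ℝ (Fin d))

/-- The rescaled errors of the jackknife estimates and of the full estimate. -/
noncomputable def rescaledErrors (x : Fin n → 𝓧) (xs : Fin (usedCount m n) → 𝓧) :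
    (Fin m → EuclideanSpace ℝ (Fin d)) × EuclideanSpace ℝ (Fin d) :=
  (fun j => (√(blockCount m n : ℝ) * ((m : ℝ) - 1)) • (jackEstimate t m n xs j - β₀),
    √(n : ℝ) • (t n x - β₀))

variable {m}

lemma scatter_rescaledErrors (hm : 0 < m) (x : Fin n → 𝓧) (xs : Fin (usedCount m n) → 𝓧) :
    scatter (rescaledErrors t m n β₀ x xs).1 = ((m : ℝ) - 1) • jackCov t m n xs := by
  have hm0 : (m : ℝ) ≠ 0 := by positivity
  set s := √(blockCount m n : ℝ) * ((m : ℝ) - 1) with hs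
  have hdev : ∀ j, (rescaledErrors t m n β₀ x xs).1 j
      - (m : ℝ)⁻¹ • ∑ l, (rescaledErrors t m n β₀ x xs).1 l
      = s • (jackEstimate t m n xs j - jackMean t m n xs) := by
    intro j
    simp only [rescaledErrors, jackMean, ← Finset.smul_sum, Finset.sum_sub_distrib,
      Finset.sum_const, Finset.card_univ, Fintype.card_fin, ← Nat.cast_smul_eq_nsmul ℝ]
    rw [smul_comm, ← smul_sub, smul_sub (m : ℝ)⁻¹, smul_smul (m : ℝ)⁻¹, inv_mul_cancel₀ hm0,
      one_smul, sub_sub_sub_cancel_right]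
  have hs2 : s * s = ((m : ℝ) - 1) * (((m : ℝ) - 1) * (blockCount m n : ℝ)) := by
    rw [hs, mul_mul_mul_comm, Real.mul_self_sqrt (by positivity)]
    ring
  simp only [scatter, hdev, jackCov, WithLp.ofLp_smul, Matrix.smul_vecMulVec,
    Matrix.vecMulVec_smul, smul_smul, hs2, ← Finset.smul_sum]

lemma isUnit_scatter_rescaledErrors (hm : 1 < m) (x : Fin n → 𝓧)
    (xs : Fin (usedCount m n) → 𝓧) :
    IsUnit (scatter (rescaledErrors t m n β₀ x xs).1) ↔ IsUnit (jackCov t m n xs) := by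
  have hm1 : (m : ℝ) - 1 ≠ 0 := by
    have : (1 : ℝ) < m := by exact_mod_cast hm
    linarith
  rw [scatter_rescaledErrors t n β₀ (by omega)]
  simp [Matrix.isUnit_iff_isUnit_det, isUnit_iff_ne_zero, hm1]

/-- The scale √k (m - 1) makes the scatter matrix (m - 1) times the jackknife covariance; the
prefactor m - 1 in `hotelling` cancels this. -/
lemma jackStat_eq_hotelling (hm : 1 < m) (x : Fin n → 𝓧) (xs : Fin (usedCount m n) → 𝓧) :
    jackStat t m n β₀ x xs = hotelling (rescaledErrors t m n β₀ x xs) := by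
  have hm1 : (m : ℝ) - 1 ≠ 0 := by
    have : (1 : ℝ) < m := by exact_mod_cast hm
    linarith
  rw [hotelling, scatter_rescaledErrors t n β₀ (by omega), inv_smul_matrix, jackStat]
  simp only [rescaledErrors, WithLp.ofLp_smul, Matrix.smul_mulVec, Matrix.mulVec_smul,
    dotProduct_smul, smul_dotProduct, smul_eq_mul]
  have hn : √(n : ℝ) * √(n : ℝ) = n := Real.mul_self_sqrt (by positivity)
  rw [mul_left_comm (√(n : ℝ)), mul_inv_cancel_left₀ hm1, ← mul_assoc, hn]

variable (φ : 𝓧 → EuclideanSpace ℝ (Fin d))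

/-- The kept sample has (m - 1)k observations, so its remainder carries √((m - 1)k); a further √(m -
1) gives the scale √k (m - 1). The number `a` is free since it enters only the second component. -/
lemma rescaledErrors_fst_sub (hm : 1 < m) (xs : Fin (usedCount m n) → 𝓧) (x : Fin n → 𝓧) (a : ℝ) (j : Fin m) :
    (rescaledErrors t m n β₀ x xs).1 j
        - (leaveOneOut a (blockSums φ (blockEquiv m n) xs)).1 j
      = √((m : ℝ) - 1) • remainder t β₀ φ (keptPositions m (usedCount m n) j).card
        fun i => xs ((keptPositions m (usedCount m n) j).orderEmbOfFin rfl i) := by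
  have hpos : (0 : ℝ) < (m : ℝ) - 1 := by
    have : (1 : ℝ) < m := by exact_mod_cast hm
    linarith
  have hm' := hpos.le
  have hcard : ((keptPositions m (usedCount m n) j).card : ℝ)
      = ((m : ℝ) - 1) * blockCount m n := by
    rw [card_keptPositions]
    push_cast [hm.le]
    ring
  have hsum : (leaveOneOut a (blockSums φ (blockEquiv m n) xs)).1 j
      = (√(blockCount m n : ℝ))⁻¹ • ∑ i ∈ keptPositions m (usedCount m n) j, φ (xs i) := by
    rw [sum_keptPositions, ← (blockEquiv m n).sum_comp, Fintype.sum_prod_type_right, smul_sub,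
      Finset.smul_sum]
    rfl
  rw [hsum, remainder, sum_orderEmbOfFin _ fun i => φ (xs i), hcard, smul_sub, smul_smul,
    smul_smul, smul_smul, Real.sqrt_mul hm']
  have h1 : √((m : ℝ) - 1) * (√((m : ℝ) - 1) * √(blockCount m n : ℝ))
      = √(blockCount m n : ℝ) * ((m : ℝ) - 1) := by
    rw [← mul_assoc, Real.mul_self_sqrt hm', mul_comm]
  rw [h1]
  congr 2
  -- Without blocks, both coefficients are 0.
  rcases Nat.eq_zero_or_pos (blockCount m n) with hk | hk
  · simp [hk]
  · have hk' : (0 : ℝ) < blockCount m n := by exact_mod_cast hk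
    have h2 := Real.mul_self_sqrt hk'.le
    field_simp
    rw [sq, h2]

/-- The value a = √(N/n) with N = mk turns (mk)^{-1/2} into n^{-1/2}, so the sums over the full
sample and the subsample carry the same factor. -/
lemma rescaledErrors_snd_sub (hm : 0 < m) (xs : Fin (usedCount m n) → 𝓧) (x : Fin n → 𝓧) :
    (rescaledErrors t m n β₀ x xs).2
        - (leaveOneOut √((usedCount m n : ℝ) / n) (blockSums φ (blockEquiv m n) xs)).2
      = remainder t β₀ φ n x + (√(n : ℝ))⁻¹ • (∑ i, φ (x i) - ∑ i, φ (xs i)) := by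
  have hsum : (leaveOneOut √((usedCount m n : ℝ) / n) (blockSums φ (blockEquiv m n) xs)).2
      = (√(n : ℝ))⁻¹ • ∑ i, φ (xs i) := by
    simp only [leaveOneOut, blockSums]
    rw [← Finset.smul_sum, smul_smul, ← (blockEquiv m n).sum_comp (fun i => φ (xs i)),
      Fintype.sum_prod_type_right]
    rcases Nat.eq_zero_or_pos (blockCount m n) with hk | hk
    · have : IsEmpty (Fin (blockCount m n)) := by rw [hk]; infer_instance
      simp
    · congr 1
      have hk' : (0 : ℝ) < blockCount m n := by exact_mod_cast hk
      have hm' : (0 : ℝ) < m := by exact_mod_cast hm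
      rw [usedCount, Nat.cast_mul, Real.sqrt_div (by positivity), Real.sqrt_mul hm'.le]
      have h1 : √(m : ℝ) ≠ 0 := by positivity
      have h2 : √(blockCount m n : ℝ) ≠ 0 := by positivity
      field_simp
  have hn : √(n : ℝ) * (n : ℝ)⁻¹ = (√(n : ℝ))⁻¹ := by
    rcases Nat.eq_zero_or_pos n with rfl | hn
    · simp
    · have hn' : (0 : ℝ) < n := by exact_mod_cast hn
      rw [← div_eq_mul_inv, Real.sqrt_div_self]
  rw [hsum, remainder, smul_smul, hn, smul_sub (√(n : ℝ))⁻¹]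
  simp only [rescaledErrors]
  abel

end Rescaling

/-! ### Second moments and whitening -/

section SecondMoment

variable {𝓧 : Type*} [MeasurableSpace 𝓧] {P : Measure 𝓧} {d : ℕ}
  {φ : 𝓧 → EuclideanSpace ℝ (Fin d)}

lemma integral_inner_sq (hφ : MemLp φ 2 P) (s : EuclideanSpace ℝ (Fin d)) :
    ∫ x, inner ℝ (φ x) s ^ 2 ∂P = s.ofLp ⬝ᵥ (secondMoment P φ *ᵥ s.ofLp) := by
  have hc : ∀ a, MemLp (fun x => φ x a) 2 P := fun a =>
    (EuclideanSpace.proj (𝕜 := ℝ) a).comp_memLp' hφ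
  have hint : ∀ a b, Integrable (fun x => φ x a * φ x b) P := fun a b =>
    (hc a).integrable_mul (hc b)
  have h : ∀ x, inner ℝ (φ x) s ^ 2 = ∑ a, ∑ b, s a * s b * (φ x a * φ x b) := by
    intro x
    rw [sq, PiLp.inner_apply, Finset.sum_mul_sum]
    refine Finset.sum_congr rfl fun a _ => Finset.sum_congr rfl fun b _ => ?_
    simp only [RCLike.inner_apply, conj_trivial]
    ring
  simp only [h]
  rw [integral_finsetSum _ fun a _ => integrable_finsetSum _ fun b _ => (hint a b).const_mul _]
  simp only [dotProduct, Matrix.mulVec, Finset.mul_sum]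
  refine Finset.sum_congr rfl fun a _ => ?_
  rw [integral_finsetSum _ fun b _ => (hint a b).const_mul _]
  refine Finset.sum_congr rfl fun b _ => ?_
  rw [integral_const_mul, secondMoment, Matrix.of_apply]
  ring

lemma posSemidef_secondMoment (hφ : MemLp φ 2 P) : (secondMoment P φ).PosSemidef := by
  refine .of_dotProduct_mulVec_nonneg ?_ fun x => ?_
  · ext a b
    simp [secondMoment, mul_comm]
  · have := integral_inner_sq hφ (WithLp.toLp 2 x)
    simp only at this
    rw [star_trivial, ← this]
    exact integral_nonneg fun _ => sq_nonneg _

/-- A whitening of `φ`: a linear image with second moments given by the identity matrix. -/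
lemma exists_whitening [IsProbabilityMeasure P] (hφ : MemLp φ 2 P) (h0 : ∫ x, φ x ∂P = 0)
    (hunit : IsUnit (secondMoment P φ)) :
    ∃ A B : Matrix (Fin d) (Fin d) ℝ, IsUnit A ∧ A * B = 1 ∧
      (∀ s, ∫ x, inner ℝ (Matrix.toEuclideanCLM (𝕜 := ℝ) B (φ x)) s ∂P = 0) ∧
      ∀ s, ∫ x, inner ℝ (Matrix.toEuclideanCLM (𝕜 := ℝ) B (φ x)) s ^ 2 ∂P = ‖s‖ ^ 2 := by
  open scoped MatrixOrder in
  -- The symmetric square root A of Σ = E[φ φᵀ] inherits invertibility, and A⁻¹ Σ A⁻¹ = 1.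
  set A := CFC.sqrt (secondMoment P φ)
  have hpos := posSemidef_secondMoment hφ
  have hAA : A * A = secondMoment P φ := CFC.sqrt_mul_sqrt_self _ hpos.nonneg
  have hAT : Aᵀ = A := by
    have : A.IsHermitian := (CFC.sqrt_nonneg (secondMoment P φ)).isSelfAdjoint
    simpa [Matrix.IsHermitian, Matrix.conjTranspose_eq_transpose_of_trivial] using this
  have hA : IsUnit A := by
    rw [← hAA] at hunit
    exact isUnit_of_mul_isUnit_left hunit
  have hdet := (Matrix.isUnit_iff_isUnit_det A).1 hA
  have hBT : (A⁻¹)ᵀ = A⁻¹ := by rw [Matrix.transpose_nonsing_inv, hAT]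
  have hinner : ∀ v s : EuclideanSpace ℝ (Fin d),
      inner ℝ (Matrix.toEuclideanCLM (𝕜 := ℝ) A⁻¹ v) s
        = inner ℝ v (Matrix.toEuclideanCLM (𝕜 := ℝ) A⁻¹ s) := by
    intro v s
    simp only [EuclideanSpace.inner_eq_star_dotProduct, Matrix.ofLp_toEuclideanCLM, star_trivial]
    rw [Matrix.dotProduct_mulVec, ← Matrix.mulVec_transpose, hBT]
  refine ⟨A, A⁻¹, hA, Matrix.mul_nonsing_inv _ hdet, fun s => ?_, fun s => ?_⟩
  · simp only [hinner]
    have := integral_inner (𝕜 := ℝ) (hφ.integrable (by norm_num))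
      (Matrix.toEuclideanCLM (𝕜 := ℝ) A⁻¹ s)
    rw [h0, inner_zero_right] at this
    rw [← this]
    exact integral_congr_ae (ae_of_all _ fun x => real_inner_comm _ _)
  · simp only [hinner]
    rw [integral_inner_sq hφ, ← hAA, Matrix.ofLp_toEuclideanCLM, Matrix.mulVec_mulVec,
      mul_assoc, Matrix.mul_nonsing_inv _ hdet, mul_one, ← Matrix.vecMul_transpose,
      hBT, ← Matrix.dotProduct_mulVec, Matrix.mulVec_mulVec, Matrix.nonsing_inv_mul _ hdet,
      Matrix.one_mulVec, ← real_inner_self_eq_norm_sq, EuclideanSpace.inner_eq_star_dotProduct,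
      star_trivial]

end SecondMoment

/-! ### Joint convergence of the rescaled errors and the theorem -/

section Main

lemma blockSums_leftInverse {𝓧 : Type*} {d m : ℕ}
    {L K : EuclideanSpace ℝ (Fin d) →L[ℝ] EuclideanSpace ℝ (Fin d)}
    (hLK : Function.LeftInverse L K) (φ : 𝓧 → EuclideanSpace ℝ (Fin d)) {k N : ℕ}
    (e : Fin k × Fin m ≃ Fin N) (x : Fin N → 𝓧) :
    (fun j => L (blockSums (fun y => K (φ y)) e x j)) = blockSums φ e x := by
  ext1 j
  simp only [blockSums, map_smul, map_sum, hLK (φ _)]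

variable {Ω 𝓧 : Type*} [MeasurableSpace Ω] [MeasurableSpace 𝓧]
  {μ : Measure Ω} {P : Measure 𝓧} {d m : ℕ}

lemma measurable_rescaledErrors {t : (n : ℕ) → (Fin n → 𝓧) → EuclideanSpace ℝ (Fin d)}
    (ht : ∀ n, Measurable (t n)) (β₀ : EuclideanSpace ℝ (Fin d)) (n : ℕ) :
    Measurable fun p : (Fin n → 𝓧) × (Fin (usedCount m n) → 𝓧) =>
      rescaledErrors t m n β₀ p.1 p.2 := by
  have h1 : ∀ j, Measurable fun p : (Fin n → 𝓧) × (Fin (usedCount m n) → 𝓧) =>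
      jackEstimate t m n p.2 j := fun j => (ht _).comp (by fun_prop)
  have := ht n
  unfold rescaledErrors
  fun_prop

variable {X : ℕ → Ω → 𝓧} {σ : (n : ℕ) → Ω → Fin (usedCount m n) → Fin n}

lemma hasLaw_firstObservations (hX_law : ∀ i, HasLaw (X i) P μ) (hX_indep : iIndepFun X μ)
    (n : ℕ) : HasLaw (fun ω (i : Fin n) => X i ω) (Measure.pi fun _ => P) μ :=
  (hX_indep.precomp (Fin.val_injective (n := n))).hasLaw_pi fun i => hX_law i

variable [IsProbabilityMeasure μ]

lemma hasLaw_indices_prod (hX_law : ∀ i, HasLaw (X i) P μ) (hX_indep : iIndepFun X μ)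
    (hσ_law : ∀ n, HasLaw (σ n)
      (uniformOn {f : Fin (usedCount m n) → Fin n | Function.Injective f}) μ)
    (hσ_indep : ∀ n, IndepFun (σ n) (fun ω (i : Fin n) => X i ω) μ) (n : ℕ) :
    HasLaw (fun ω => (σ n ω, fun i : Fin n => X i ω))
      ((uniformOn {f : Fin (usedCount m n) → Fin n | Function.Injective f}).prod
        (Measure.pi fun _ => P)) μ :=
  (hσ_indep n).hasLaw_prod (hσ_law n) (hasLaw_firstObservations hX_law hX_indep n)

variable [IsProbabilityMeasure P]

lemma hasLaw_resample (hX_law : ∀ i, HasLaw (X i) P μ) (hX_indep : iIndepFun X μ)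
    (hσ_law : ∀ n, HasLaw (σ n)
      (uniformOn {f : Fin (usedCount m n) → Fin n | Function.Injective f}) μ)
    (hσ_indep : ∀ n, IndepFun (σ n) (fun ω (i : Fin n) => X i ω) μ) (n : ℕ) :
    HasLaw (resample X m σ n) (Measure.pi fun _ => P) μ := by
  have h := ae_injective_uniformOn (usedCount_le m n)
  have := h.1
  exact (hasLaw_sample h.2).comp (hasLaw_indices_prod hX_law hX_indep hσ_law hσ_indep n)

/-- At most m observations are missing from the subsample, so the difference of the sums is bounded
in L¹ uniformly in n, and the factor n^{-1/2} sends it to 0. -/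
lemma tendstoInMeasure_sum_sub_sum_resample {E : Type*} [NormedAddCommGroup E] [NormedSpace ℝ E]
    [MeasurableSpace E] [BorelSpace E] [SecondCountableTopology E] (hm : 0 < m)
    (hX_law : ∀ i, HasLaw (X i) P μ) (hX_indep : iIndepFun X μ)
    (hσ_law : ∀ n, HasLaw (σ n)
      (uniformOn {f : Fin (usedCount m n) → Fin n | Function.Injective f}) μ)
    (hσ_indep : ∀ n, IndepFun (σ n) (fun ω (i : Fin n) => X i ω) μ)
    {φ : 𝓧 → E} (hφ : Measurable φ) (hint : Integrable φ P) :
    TendstoInMeasure μ (fun (n : ℕ) ω => (√(n : ℝ))⁻¹ •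
      (∑ i : Fin n, φ (X i ω) - ∑ i, φ (resample X m σ n ω i))) atTop fun _ => 0 := by
  set D : (n : ℕ) → (Fin (usedCount m n) → Fin n) × (Fin n → 𝓧) → E := fun n p =>
    ∑ i, φ (p.2 i) - ∑ i, φ (p.2 (p.1 i)) with hD
  have hDm : ∀ n, Measurable (D n) := by
    intro n
    refine Measurable.sub (by fun_prop) ?_
    have : Measurable fun x : Fin (usedCount m n) → 𝓧 => ∑ i, φ (x i) := by fun_prop
    exact this.comp measurable_sample
  have hlaw := hasLaw_indices_prod hX_law hX_indep hσ_law hσ_indep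
  have hbound : ∀ n, ∫⁻ ω, ‖D n (σ n ω, fun i : Fin n => X i ω)‖ₑ ∂μ
      ≤ m * ∫⁻ x, ‖φ x‖ₑ ∂P := by
    intro n
    have h := ae_injective_uniformOn (usedCount_le m n)
    have := h.1
    rw [(hlaw n).lintegral_comp (f := fun p => ‖D n p‖ₑ) (hDm n).enorm.aemeasurable]
    refine (lintegral_enorm_sum_sub_sum_sample_le hφ h.2).trans ?_
    gcongr
    have := lt_usedCount_add hm n
    omega
  refine tendstoInMeasure_of_tendsto_eLpNorm one_ne_zero (fun n => ?_)
    aestronglyMeasurable_const ?_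
  · exact (((hDm n).comp_aemeasurable (hlaw n).aemeasurable).const_smul
      (√(n : ℝ))⁻¹).aestronglyMeasurable
  · have hlim : Tendsto (fun n : ℕ => ‖(√(n : ℝ))⁻¹‖ₑ * (m * ∫⁻ x, ‖φ x‖ₑ ∂P)) atTop (𝓝 0) := by
      have h1 : Tendsto (fun n : ℕ => (√(n : ℝ))⁻¹) atTop (𝓝 0) :=
        tendsto_inv_atTop_zero.comp (Real.tendsto_sqrt_atTop.comp tendsto_natCast_atTop_atTop)
      have h2 := h1.enorm
      rw [enorm_zero] at h2
      have h3 := ENNReal.Tendsto.mul_const (b := m * ∫⁻ x, ‖φ x‖ₑ ∂P) h2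
        (Or.inr (ENNReal.mul_ne_top (by simp) hint.2.ne))
      rwa [zero_mul] at h3
    refine tendsto_of_tendsto_of_tendsto_of_le_of_le tendsto_const_nhds hlim
      (fun _ => zero_le) fun n => ?_
    rw [eLpNorm_one_eq_lintegral_enorm]
    simp only [Pi.sub_apply, sub_zero, enorm_smul]
    rw [lintegral_const_mul' _ _ enorm_ne_top]
    gcongr
    exact hbound n

/-- The rescaled errors converge jointly to linear images of independent Gaussian vectors. -/
lemma tendstoInDistribution_rescaledErrors (hm : 1 < m)
    (hX_law : ∀ i, HasLaw (X i) P μ) (hX_indep : iIndepFun X μ)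
    {t : (n : ℕ) → (Fin n → 𝓧) → EuclideanSpace ℝ (Fin d)} (ht : ∀ n, Measurable (t n))
    (β₀ : EuclideanSpace ℝ (Fin d))
    {φ : 𝓧 → EuclideanSpace ℝ (Fin d)} (hφ : Measurable φ) (hint : Integrable φ P)
    {L K : EuclideanSpace ℝ (Fin d) →L[ℝ] EuclideanSpace ℝ (Fin d)}
    (hLK : Function.LeftInverse L K)
    (h0 : ∀ s, ∫ x, inner ℝ (K (φ x)) s ∂P = 0)
    (h1 : ∀ s, ∫ x, inner ℝ (K (φ x)) s ^ 2 ∂P = ‖s‖ ^ 2)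
    (h_lin : TendstoInMeasure μ
      (fun (n : ℕ) ω => remainder t β₀ φ n (fun i : Fin n => X i ω)) atTop (fun _ => 0))
    (hσ_law : ∀ n, HasLaw (σ n)
      (uniformOn {f : Fin (usedCount m n) → Fin n | Function.Injective f}) μ)
    (hσ_indep : ∀ n, IndepFun (σ n) (fun ω (i : Fin n) => X i ω) μ) :
    TendstoInDistribution
      (fun n ω => rescaledErrors t m n β₀ (fun i => X i ω) (resample X m σ n ω)) atTop
      (fun z => leaveOneOut 1 fun j => L (z j)) (fun _ => μ)
      (Measure.pi fun _ : Fin m => stdGaussian (EuclideanSpace ℝ (Fin d))) := by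
  have hm0 : 0 < m := by omega
  have hXX := hasLaw_firstObservations hX_law hX_indep
  have hres := hasLaw_resample hX_law hX_indep hσ_law hσ_indep
  have hclt := tendstoInDistribution_blockSums (k := blockCount m) (N := usedCount m)
    (ψ := fun y => K (φ y)) (by fun_prop) h0 h1
    (tendsto_blockCount hm0) (blockEquiv m) (resample X m σ) hres
  have hconst : TendstoInMeasure μ
      (fun (n : ℕ) (_ : Ω) => √((usedCount m n : ℝ) / n)) atTop (fun _ => (1 : ℝ)) :=
    tendstoInMeasure_of_tendsto_ae (fun _ => aestronglyMeasurable_const)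
      (ae_of_all _ fun _ => tendsto_usedCount_div hm0)
  have hcont : Continuous fun p : (Fin m → EuclideanSpace ℝ (Fin d)) × ℝ =>
      leaveOneOut p.2 fun j => L (p.1 j) := by
    have h : Continuous fun p : (Fin m → EuclideanSpace ℝ (Fin d)) × ℝ =>
        ((fun j => L (p.1 j)), p.2) := by fun_prop
    have hc := continuous_leaveOneOut.comp h
    exact hc
  -- Slutsky's theorem with √(N/n) → 1 allows the coefficient that fits the errors exactly at each
  -- n.
  have hlead := hclt.continuous_comp_prodMk_of_tendstoInMeasure_const hcont hconst
    fun _ => aemeasurable_const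
  simp only [blockSums_leftInverse hLK, id_eq] at hlead
  have hcard : ∀ j : Fin m,
      Tendsto (fun n => (keptPositions m (usedCount m n) j).card) atTop atTop := by
    intro j
    simp only [card_keptPositions]
    exact Tendsto.const_mul_atTop' (by omega) (tendsto_blockCount hm0)
  have hrem : ∀ j : Fin m, TendstoInMeasure μ (fun n ω =>
      remainder t β₀ φ (keptPositions m (usedCount m n) j).card
        fun i => resample X m σ n ω
          ((keptPositions m (usedCount m n) j).orderEmbOfFin rfl i)) atTop fun _ => 0 := fun j =>
    tendstoInMeasure_remainder ht hφ hXX h_lin (hcard j) fun n => (hasLaw_pi_comp_injective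
      ((keptPositions m (usedCount m n) j).orderEmbOfFin rfl).injective).comp (hres n)
  set D : ℕ → Ω → (Fin m → EuclideanSpace ℝ (Fin d)) × EuclideanSpace ℝ (Fin d) := fun n ω =>
    rescaledErrors t m n β₀ (fun i => X i ω) (resample X m σ n ω)
      - leaveOneOut √((usedCount m n : ℝ) / n)
        (blockSums φ (blockEquiv m n) (resample X m σ n ω)) with hD
  have hdiff : TendstoInMeasure μ D atTop fun _ => 0 := by
    refine tendstoInMeasure_zero_pi_prod (fun j => ?_) ?_
    · simp only [hD, Prod.fst_sub, Pi.sub_apply, rescaledErrors_fst_sub t _ β₀ φ hm]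
      exact tendstoInMeasure_zero_const_smul _ (hrem j)
    · simp only [hD, Prod.snd_sub, rescaledErrors_snd_sub t _ β₀ φ hm0]
      exact tendstoInMeasure_zero_add h_lin
        (tendstoInMeasure_sum_sub_sum_resample hm0 hX_law hX_indep hσ_law hσ_indep hφ hint)
  have hmeas : ∀ n, AEMeasurable
      (fun ω => rescaledErrors t m n β₀ (fun i => X i ω) (resample X m σ n ω)) μ := by
    intro n
    have hc := (measurable_rescaledErrors (m := m) ht β₀ n).comp_aemeasurable
      ((hXX n).aemeasurable.prodMk (hres n).aemeasurable)
    exact hc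
  exact tendstoInDistribution_of_tendstoInMeasure_sub _ _ hlead hdiff hmeas

end Main

end BlockJackknife

theorem lemma5
    {Ω 𝓧 : Type*} [MeasurableSpace Ω] [MeasurableSpace 𝓧]
    (μ : Measure Ω) [IsProbabilityMeasure μ] (P : Measure 𝓧) [IsProbabilityMeasure P]
    (d m : ℕ) (hd : 0 < d) (hm : d < m)
    -- the i.i.d. data
    (X : ℕ → Ω → 𝓧) (hX_law : ∀ i, HasLaw (X i) P μ) (hX_indep : iIndepFun X μ)
    -- the estimation method, asymptotically linear with influence function `φ`
    (t : (n : ℕ) → (Fin n → 𝓧) → EuclideanSpace ℝ (Fin d)) (ht : ∀ n, Measurable (t n))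
    (β₀ : EuclideanSpace ℝ (Fin d))
    (φ : 𝓧 → EuclideanSpace ℝ (Fin d)) (hφ_sq : MemLp φ 2 P) (hφ_mean : ∫ x, φ x ∂P = 0)
    (hφ_nonsing : IsUnit (BlockJackknife.secondMoment P φ))
    (h_lin : TendstoInMeasure μ
      (fun (n : ℕ) ω => √(n : ℝ) • (t n (fun i => X i ω) - β₀)
        - √(n : ℝ) • ((n : ℝ)⁻¹ • ∑ i : Fin n, φ (X i ω)))
      atTop (fun _ => 0))
    -- uniform sampling without replacement, independent of the data
    (σ : (n : ℕ) → Ω → Fin (BlockJackknife.usedCount m n) → Fin n)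
    (hσ_law : ∀ n, HasLaw (σ n)
      (uniformOn {f : Fin (BlockJackknife.usedCount m n) → Fin n | Function.Injective f}) μ)
    (hσ_indep : ∀ n, IndepFun (σ n) (fun ω (i : Fin n) => X i ω) μ) :
    Tendsto (fun n => μ {ω | IsUnit (BlockJackknife.jackCov t m n
        (BlockJackknife.resample X m σ n ω))}) atTop (𝓝 1) ∧
    TendstoInDistribution
      (fun n ω => BlockJackknife.jackStat t m n β₀ (fun i => X i ω)
        (BlockJackknife.resample X m σ n ω))
      atTop
      (fun x : ℝ => (d : ℝ) * ((m : ℝ) - 1) / ((m : ℝ) - d) * x)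
      (fun _ => μ) (BlockJackknife.fDist d (m - d)) := by
  have hm1 : 1 < m := by omega
  -- Square integrability gives only almost everywhere measurability; a measurable version of `φ`
  -- has the same moments and almost surely agrees with `φ` at all X_i.
  obtain ⟨φ', hφ'm, hφφ'⟩ := hφ_sq.aestronglyMeasurable.aemeasurable
  have hφ'_sq : MemLp φ' 2 P := (memLp_congr_ae hφφ').1 hφ_sq
  have hφ'_mean : ∫ x, φ' x ∂P = 0 := by rw [← hφ_mean, integral_congr_ae hφφ']
  have hφ'_unit : IsUnit (BlockJackknife.secondMoment P φ') := by
    have : BlockJackknife.secondMoment P φ' = BlockJackknife.secondMoment P φ := by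
      ext a b
      refine integral_congr_ae ?_
      filter_upwards [hφφ'] with x hx
      rw [hx]
    rwa [this]
  have hφX : ∀ᵐ ω ∂μ, ∀ i, φ (X i ω) = φ' (X i ω) := by
    rw [ae_all_iff]
    intro i
    have h := hφφ'
    rw [← (hX_law i).map_eq] at h
    exact ae_of_ae_map (hX_law i).aemeasurable h
  have h_lin' : TendstoInMeasure μ
      (fun (n : ℕ) ω => BlockJackknife.remainder t β₀ φ' n (fun i : Fin n => X i ω)) atTop
      (fun _ => 0) := by
    refine h_lin.congr_left fun n => ?_
    filter_upwards [hφX] with ω hω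
    simp only [BlockJackknife.remainder, hω]
  obtain ⟨A, B, hA, hAB, h0, h1⟩ :=
    BlockJackknife.exists_whitening hφ'_sq hφ'_mean hφ'_unit
  have hLK : Function.LeftInverse (Matrix.toEuclideanCLM (n := Fin d) (𝕜 := ℝ) A)
      (Matrix.toEuclideanCLM (n := Fin d) (𝕜 := ℝ) B) := fun v => by
    rw [← mul_apply_eq_comp, ← map_mul, hAB, map_one, one_apply_eq_self]
  have hdist := BlockJackknife.tendstoInDistribution_rescaledErrors hm1 hX_law hX_indep ht β₀
    hφ'm (hφ'_sq.integrable (by norm_num)) hLK h0 h1 h_lin' hσ_law hσ_indep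
  have hU := BlockJackknife.ae_isUnit_scatter_leaveOneOut hm hA
  have hopen := BlockJackknife.isOpen_isUnit_scatter (m := m) (d := d)
  refine ⟨?_, ?_⟩
  · have := BlockJackknife.tendsto_measure_one_of_tendstoInDistribution hdist hopen hU
    simpa only [Set.mem_ofPred_eq,
      BlockJackknife.isUnit_scatter_rescaledErrors t _ β₀ hm1] using this
  · have h := BlockJackknife.tendstoInDistribution_comp_of_continuousOn hdist hopen hU
      BlockJackknife.measurable_hotelling BlockJackknife.continuousOn_hotelling
    simp only [← BlockJackknife.jackStat_eq_hotelling t _ β₀ hm1] at h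
    refine ⟨h.forall_aemeasurable, by fun_prop, ?_⟩
    convert h.tendsto using 1
    exact congrArg 𝓝 (Subtype.ext (BlockJackknife.map_hotelling_leaveOneOut hd hm hA).symm)
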